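/- Let $\mathbb{K}$ be a field and $1\le n\le 10$. **Definitions.** A sub-partial-monoid of $[0,n-1]=\{0,1,\dots,n-1\}$ is a subset $E\ni 0$ such that $a,b\in E$ and $a+b\le n-1$ imply $a+b\in E$. Its number $d(E)$ is the least cardinality of a subset $G\subseteq E$ such that $E$ is the smallest sub-partial-monoid of $[0,n-1]$ containing $G$. The number $e(E)=e_n(E)$ is defined by $e_1(E)=0$ and, for $n>1$, $e_n(E)=e_{n-1}(E\setminus\{n-1\})$ if $n-1\in E$ and $e_n(E)=d(E)+e_{n-1}(E)$ if $n-1\notin E$. For a $\mathbb{K}$-subalgebra $R\subseteq\mathbb{K}[x]/x^n$, the exponent set $E(R)$ is the set of valuations of the monic elements of $R$, that is, of those $i\in[0,n-1]$ such that $R$ contains an element of the form $x^i+(\text{terms of degree}>i)$. **Theorem.** The table for $n$ below is correct, in the following sense. 1. The first column lists every sub-partial-monoid $E$ of $[0,n-1]$ exactly once, and nothing else. 2. The second column is the value of $e(E)$; it is also the number $e$ of letters $a,b,c,\dots$ that occur in the row. 3. For each row, the map that sends $(a,b,c,\dots)\in\mathbb{K}^{e}$ to the $\mathbb{K}$-subalgebra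 of $\mathbb{K}[x]/x^n$ generated (as a unital algebra) by the listed elements is a bijection from the affine space $\mathbb{K}^{e}$ onto the set of all subalgebras $R\subseteq\mathbb{K}[x]/x^n$ with $E(R)=E$. 4. For each row and all values of the letters, the listed generators belong to the maximal ideal $\mathcal m$ of the (local) algebra $R$ that they generate, and they are linearly independent over $\mathbb{K}$ modulo $\mathcal m^2$. Moreover, for every $\mathbb{K}$-subalgebra $R\subseteq\mathbb{K}[x]/x^n$, the set $E(R)$ is a sub-partial-monoid of $[0,n-1]$ (so that $R$ occurs in the table), $R$ is a local ring, and its maximal ideal $\mathcal m$ satisfies $\dim_{\mathbb{K}}(\mathcal m/\mathcal m^2)=d(E(R))$, i.e. $R$ is thin. **The tables.** The letters denote arbitrary elements of $\mathbb{K}$. The algebra $\mathbb{K}$ is entered with the empty set of generators, and $\mathbb{K}[x]/x^n$, for $n>1$, with the generator $x$. Table for $n=1$: $$\begin{array}{|c|c|c|} \hline E & e(E) & \text{generators}\\ \hline \{0\} & 0 & \varnothing\\ \hline \end{array}$$ Table for $n=2$: $$\begin{array}{|c|c|c|} \hline E & e(E) & \text{generators}\\ \hline \{0, 1\} & 0 &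 \{x\}\\ \{0\} & 0 & \varnothing\\ \hline \end{array}$$ Table for $n=3$: $$\begin{array}{|c|c|c|} \hline E & e(E) & \text{generators}\\ \hline \{0, 1, 2\} & 0 & \{x\}\\ \{0, 2\} & 0 & \{x^2\}\\ \{0\} & 0 & \varnothing\\ \hline \end{array}$$ Table for $n=4$: $$\begin{array}{|c|c|c|} \hline E & e(E) & \text{generators}\\ \hline \{0, 1, 2, 3\} & 0 & \{x\}\\ \{0, 2, 3\} & 0 & \{x^2, x^3\}\\ \{0, 3\} & 0 & \{x^3\}\\ \{0, 2\} & 1 & \{x^2+ax^3\}\\ \{0\} & 0 & \varnothing\\ \hline \end{array}$$ Table for $n=5$: $$\begin{array}{|c|c|c|} \hline E & e(E) & \text{generators}\\ \hline \{0, 1, 2, 3, 4\} & 0 & \{x\}\\ \{0, 2, 3, 4\} & 0 & \{x^2, x^3\}\\ \{0, 3, 4\} & 0 & \{x^3, x^4\}\\ \{0, 2, 4\} & 1 & \{x^2+ax^3\}\\ \{0, 4\} & 0 & \{x^4\}\\ \{0, 3\} & 1 & \{x^3+ax^4\}\\ \{0\} & 0 & \varnothing\\ \hline \end{array}$$ Table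 for $n=6$: $$\begin{array}{|c|c|c|} \hline E & e(E) & \text{generators}\\ \hline \{0, 1, 2, 3, 4, 5\} & 0 & \{x\}\\ \{0, 2, 3, 4, 5\} & 0 & \{x^2, x^3\}\\ \{0, 3, 4, 5\} & 0 & \{x^3, x^4, x^5\}\\ \{0, 2, 4, 5\} & 1 & \{x^2+ax^3, x^5\}\\ \{0, 4, 5\} & 0 & \{x^4, x^5\}\\ \{0, 3, 5\} & 1 & \{x^3+ax^4, x^5\}\\ \{0, 5\} & 0 & \{x^5\}\\ \{0, 3, 4\} & 2 & \{x^3+ax^5, x^4+bx^5\}\\ \{0, 2, 4\} & 2 & \{x^2+ax^3+bx^5\}\\ \{0, 4\} & 1 & \{x^4+ax^5\}\\ \{0, 3\} & 2 & \{x^3+ax^4+bx^5\}\\ \{0\} & 0 & \varnothing\\ \hline \end{array}$$ Table for $n=7$: $$\begin{array}{|c|c|c|} \hline E & e(E) & \text{generators}\\ \hline \{0, 1, 2, 3, 4, 5, 6\} & 0 & \{x\}\\ \{0, 2, 3, 4, 5, 6\} & 0 & \{x^2, x^3\}\\ \{0, 3, 4, 5, 6\} & 0 & \{x^3, x^4,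 x^5\}\\ \{0, 2, 4, 5, 6\} & 1 & \{x^2+ax^3, x^5\}\\ \{0, 4, 5, 6\} & 0 & \{x^4, x^5, x^6\}\\ \{0, 3, 5, 6\} & 1 & \{x^3+ax^4, x^5\}\\ \{0, 5, 6\} & 0 & \{x^5, x^6\}\\ \{0, 3, 4, 6\} & 2 & \{x^3+ax^5, x^4+bx^5\}\\ \{0, 2, 4, 6\} & 2 & \{x^2+ax^3+bx^5\}\\ \{0, 4, 6\} & 1 & \{x^4+ax^5, x^6\}\\ \{0, 3, 6\} & 2 & \{x^3+ax^4+bx^5\}\\ \{0, 6\} & 0 & \{x^6\}\\ \{0, 4, 5\} & 2 & \{x^4+ax^6, x^5+bx^6\}\\ \{0, 5\} & 1 & \{x^5+ax^6\}\\ \{0, 4\} & 2 & \{x^4+ax^5+bx^6\}\\ \{0\} & 0 & \varnothing\\ \hline \end{array}$$ Table for $n=8$: $$\begin{array}{|c|c|c|} \hline E & e(E) & \text{generators}\\ \hline \{0, 1, 2, 3, 4, 5, 6, 7\} & 0 & \{x\}\\ \{0, 2, 3, 4, 5, 6, 7\} & 0 & \{x^2, x^3\}\\ \{0, 3, 4,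 5, 6, 7\} & 0 & \{x^3, x^4, x^5\}\\ \{0, 2, 4, 5, 6, 7\} & 1 & \{x^2+ax^3, x^5\}\\ \{0, 4, 5, 6, 7\} & 0 & \{x^4, x^5, x^6, x^7\}\\ \{0, 3, 5, 6, 7\} & 1 & \{x^3+ax^4, x^5, x^7\}\\ \{0, 5, 6, 7\} & 0 & \{x^5, x^6, x^7\}\\ \{0, 3, 4, 6, 7\} & 2 & \{x^3+ax^5, x^4+bx^5\}\\ \{0, 2, 4, 6, 7\} & 2 & \{x^2+ax^3+bx^5, x^7\}\\ \{0, 4, 6, 7\} & 1 & \{x^4+ax^5, x^6, x^7\}\\ \{0, 3, 6, 7\} & 2 & \{x^3+ax^4+bx^5, x^7\}\\ \{0, 6, 7\} & 0 & \{x^6, x^7\}\\ \{0, 4, 5, 7\} & 2 & \{x^4+ax^6, x^5+bx^6, x^7\}\\ \{0, 5, 7\} & 1 & \{x^5+ax^6, x^7\}\\ \{0, 4, 7\} & 2 & \{x^4+ax^5+bx^6, x^7\}\\ \{0, 7\} & 0 & \{x^7\}\\ \{0, 4, 5, 6\} & 3 & \{x^4+ax^7, x^5+bx^7, x^6+cx^7\}\\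 \{0, 3, 5, 6\} & 3 & \{x^3+ax^4+bx^7, x^5+cx^7\}\\ \{0, 5, 6\} & 2 & \{x^5+ax^7, x^6+bx^7\}\\ \{0, 2, 4, 6\} & 3 & \{x^2+ax^3+bx^5+cx^7\}\\ \{0, 4, 6\} & 3 & \{x^4+ax^5+bx^7, x^6+cx^7\}\\ \{0, 3, 6\} & 3 & \{x^3+ax^4+bx^5+cx^7\}\\ \{0, 6\} & 1 & \{x^6+ax^7\}\\ \{0, 4, 5\} & 4 & \{x^4+ax^6+cx^7, x^5+bx^6+dx^7\}\\ \{0, 5\} & 2 & \{x^5+ax^6+bx^7\}\\ \{0, 4\} & 3 & \{x^4+ax^5+bx^6+cx^7\}\\ \{0\} & 0 & \varnothing\\ \hline \end{array}$$ Table for $n=9$: $$\begin{array}{|c|c|c|} \hline E & e(E) & \text{generators}\\ \hline \{0, 1, 2, 3, 4, 5, 6, 7, 8\} & 0 & \{x\}\\ \{0, 2, 3, 4, 5, 6, 7, 8\} & 0 & \{x^2, x^3\}\\ \{0, 3, 4, 5, 6, 7, 8\} & 0 & \{x^3, x^4, x^5\}\\ \{0, 2, 4, 5, 6, 7, 8\}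 & 1 & \{x^2+ax^3, x^5\}\\ \{0, 4, 5, 6, 7, 8\} & 0 & \{x^4, x^5, x^6, x^7\}\\ \{0, 3, 5, 6, 7, 8\} & 1 & \{x^3+ax^4, x^5, x^7\}\\ \{0, 5, 6, 7, 8\} & 0 & \{x^5, x^6, x^7, x^8\}\\ \{0, 3, 4, 6, 7, 8\} & 2 & \{x^3+ax^5, x^4+bx^5\}\\ \{0, 2, 4, 6, 7, 8\} & 2 & \{x^2+ax^3+bx^5, x^7\}\\ \{0, 4, 6, 7, 8\} & 1 & \{x^4+ax^5, x^6, x^7\}\\ \{0, 3, 6, 7, 8\} & 2 & \{x^3+ax^4+bx^5, x^7, x^8\}\\ \{0, 6, 7, 8\} & 0 & \{x^6, x^7, x^8\}\\ \{0, 4, 5, 7, 8\} & 2 & \{x^4+ax^6, x^5+bx^6, x^7\}\\ \{0, 5, 7, 8\} & 1 & \{x^5+ax^6, x^7, x^8\}\\ \{0, 4, 7, 8\} & 2 & \{x^4+ax^5+bx^6, x^7\}\\ \{0, 7, 8\} & 0 & \{x^7, x^8\}\\ \{0, 4, 5, 6, 8\} & 3 & \{x^4+ax^7, x^5+bx^7,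 x^6+cx^7\}\\ \{0, 3, 5, 6, 8\} & 3 & \{x^3+ax^4+bx^7, x^5+cx^7\}\\ \{0, 5, 6, 8\} & 2 & \{x^5+ax^7, x^6+bx^7, x^8\}\\ \{0, 2, 4, 6, 8\} & 3 & \{x^2+ax^3+bx^5+cx^7\}\\ \{0, 4, 6, 8\} & 3 & \{x^4+ax^5+bx^7, x^6+cx^7\}\\ \{0, 3, 6, 8\} & 3 & \{x^3+ax^4+bx^5+cx^7, x^8\}\\ \{0, 6, 8\} & 1 & \{x^6+ax^7, x^8\}\\ \{0, 4, 5, 8\} & 4 & \{x^4+ax^6+cx^7, x^5+bx^6+dx^7\}\\ \{0, 5, 8\} & 2 & \{x^5+ax^6+bx^7, x^8\}\\ \{0, 4, 8\} & 3 & \{x^4+ax^5+bx^6+cx^7\}\\ \{0, 8\} & 0 & \{x^8\}\\ \{0, 5, 6, 7\} & 3 & \{x^5+ax^8, x^6+bx^8, x^7+cx^8\}\\ \{0, 3, 6, 7\} & 4 & \{x^3+ax^4+bx^5+cx^8, x^7+dx^8\}\\ \{0, 6, 7\} & 2 & \{x^6+ax^8, x^7+bx^8\}\\ \{0, 5, 7\}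 & 3 & \{x^5+ax^6+bx^8, x^7+cx^8\}\\ \{0, 7\} & 1 & \{x^7+ax^8\}\\ \{0, 5, 6\} & 4 & \{x^5+ax^7+cx^8, x^6+bx^7+dx^8\}\\ \{0, 3, 6\} & 4 & \{x^3+ax^4+bx^5+cx^7+dx^8\}\\ \{0, 6\} & 2 & \{x^6+ax^7+bx^8\}\\ \{0, 5\} & 3 & \{x^5+ax^6+bx^7+cx^8\}\\ \{0\} & 0 & \varnothing\\ \hline \end{array}$$ Table for $n=10$: $$\begin{array}{|c|c|c|} \hline E & e(E) & \text{generators}\\ \hline \{0, 1, 2, 3, 4, 5, 6, 7, 8, 9\} & 0 & \{x\}\\ \{0, 2, 3, 4, 5, 6, 7, 8, 9\} & 0 & \{x^2, x^3\}\\ \{0, 3, 4, 5, 6, 7, 8, 9\} & 0 & \{x^3, x^4, x^5\}\\ \{0, 2, 4, 5, 6, 7, 8, 9\} & 1 & \{x^2+ax^3, x^5\}\\ \{0, 4, 5, 6, 7, 8, 9\} & 0 & \{x^4, x^5, x^6, x^7\}\\ \{0, 3, 5, 6, 7, 8, 9\} & 1 & \{x^3+ax^4, x^5, x^7\}\\ \{0,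 5, 6, 7, 8, 9\} & 0 & \{x^5, x^6, x^7, x^8, x^9\}\\ \{0, 3, 4, 6, 7, 8, 9\} & 2 & \{x^3+ax^5, x^4+bx^5\}\\ \{0, 2, 4, 6, 7, 8, 9\} & 2 & \{x^2+ax^3+bx^5, x^7\}\\ \{0, 4, 6, 7, 8, 9\} & 1 & \{x^4+ax^5, x^6, x^7, x^9\}\\ \{0, 3, 6, 7, 8, 9\} & 2 & \{x^3+ax^4+bx^5, x^7, x^8\}\\ \{0, 6, 7, 8, 9\} & 0 & \{x^6, x^7, x^8, x^9\}\\ \{0, 4, 5, 7, 8, 9\} & 2 & \{x^4+ax^6, x^5+bx^6, x^7\}\\ \{0, 5, 7, 8, 9\} & 1 & \{x^5+ax^6, x^7, x^8, x^9\}\\ \{0, 4, 7, 8, 9\} & 2 & \{x^4+ax^5+bx^6, x^7, x^9\}\\ \{0, 7, 8, 9\} & 0 & \{x^7, x^8, x^9\}\\ \{0, 4, 5, 6, 8, 9\} & 3 & \{x^4+ax^7, x^5+bx^7, x^6+cx^7\}\\ \{0, 3, 5, 6, 8, 9\} & 3 & \{x^3+ax^4+bx^7, x^5+cx^7\}\\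 \{0, 5, 6, 8, 9\} & 2 & \{x^5+ax^7, x^6+bx^7, x^8, x^9\}\\ \{0, 2, 4, 6, 8, 9\} & 3 & \{x^2+ax^3+bx^5+cx^7, x^9\}\\ \{0, 4, 6, 8, 9\} & 3 & \{x^4+ax^5+bx^7, x^6+cx^7, x^9\}\\ \{0, 3, 6, 8, 9\} & 3 & \{x^3+ax^4+bx^5+cx^7, x^8\}\\ \{0, 6, 8, 9\} & 1 & \{x^6+ax^7, x^8, x^9\}\\ \{0, 4, 5, 8, 9\} & 4 & \{x^4+ax^6+cx^7, x^5+bx^6+dx^7\}\\ \{0, 5, 8, 9\} & 2 & \{x^5+ax^6+bx^7, x^8, x^9\}\\ \{0, 4, 8, 9\} & 3 & \{x^4+ax^5+bx^6+cx^7, x^9\}\\ \{0, 8, 9\} & 0 & \{x^8, x^9\}\\ \{0, 5, 6, 7, 9\} & 3 & \{x^5+ax^8, x^6+bx^8, x^7+cx^8, x^9\}\\ \{0, 3, 6, 7, 9\} & 4 & \{x^3+ax^4+bx^5+cx^8, x^7+dx^8\}\\ \{0, 6, 7, 9\} & 2 & \{x^6+ax^8, x^7+bx^8, x^9\}\\ \{0,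 5, 7, 9\} & 3 & \{x^5+ax^6+bx^8, x^7+cx^8, x^9\}\\ \{0, 7, 9\} & 1 & \{x^7+ax^8, x^9\}\\ \{0, 5, 6, 9\} & 4 & \{x^5+ax^7+cx^8, x^6+bx^7+dx^8, x^9\}\\ \{0, 3, 6, 9\} & 4 & \{x^3+ax^4+bx^5+cx^7+dx^8\}\\ \{0, 6, 9\} & 2 & \{x^6+ax^7+bx^8, x^9\}\\ \{0, 5, 9\} & 3 & \{x^5+ax^6+bx^7+cx^8, x^9\}\\ \{0, 9\} & 0 & \{x^9\}\\ \{0, 5, 6, 7, 8\} & 4 & \{x^5+ax^9, x^6+bx^9, x^7+cx^9, x^8+dx^9\}\\ \{0, 4, 6, 7, 8\} & 4 & \{x^4+ax^5+bx^9, x^6+cx^9, x^7+dx^9\}\\ \{0, 6, 7, 8\} & 3 & \{x^6+ax^9, x^7+bx^9, x^8+cx^9\}\\ \{0, 5, 7, 8\} & 4 & \{x^5+ax^6+bx^9, x^7+cx^9, x^8+dx^9\}\\ \{0, 4, 7, 8\} & 4 & \{x^4+ax^5+bx^6+cx^9, x^7+dx^9\}\\ \{0, 7, 8\} & 2 & \{x^7+ax^9,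 x^8+bx^9\}\\ \{0, 5, 6, 8\} & 5 & \{x^5+ax^7+cx^9, x^6+bx^7+dx^9, x^8+ex^9\}\\ \{0, 2, 4, 6, 8\} & 4 & \{x^2+ax^3+bx^5+cx^7+dx^9\}\\ \{0, 4, 6, 8\} & 5 & \{x^4+ax^5+bx^7+dx^9, x^6+cx^7+ex^9\}\\ \{0, 6, 8\} & 3 & \{x^6+ax^7+bx^9, x^8+cx^9\}\\ \{0, 5, 8\} & 4 & \{x^5+ax^6+bx^7+cx^9, x^8+dx^9\}\\ \{0, 4, 8\} & 4 & \{x^4+ax^5+bx^6+cx^7+dx^9\}\\ \{0, 8\} & 1 & \{x^8+ax^9\}\\ \{0, 5, 6, 7\} & 6 & \{x^5+ax^8+dx^9, x^6+bx^8+ex^9, x^7+cx^8+fx^9\}\\ \{0, 6, 7\} & 4 & \{x^6+ax^8+cx^9, x^7+bx^8+dx^9\}\\ \{0, 5, 7\} & 5 & \{x^5+ax^6+bx^8+dx^9, x^7+cx^8+ex^9\}\\ \{0, 7\} & 2 & \{x^7+ax^8+bx^9\}\\ \{0, 5, 6\} & 6 & \{x^5+ax^7+cx^8+ex^9, x^6+bx^7+dx^8+fx^9\}\\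 \{0, 6\} & 3 & \{x^6+ax^7+bx^8+cx^9\}\\ \{0, 5\} & 4 & \{x^5+ax^6+bx^7+cx^8+dx^9\}\\ \{0\} & 0 & \varnothing\\ \hline \end{array}$$ -/

import Mathlib

open Polynomial

namespace TruncSubalg

/-! ### Sub-partial-monoids of `[0, n-1]` and their invariants -/

/-- `E` is a sub-partial-monoid of `[0, n-1]`: it is contained in `[0, n-1]`, contains `0`, and is
closed under those sums that stay in `[0, n-1]`. -/
def IsSubPartialMonoid (n : ℕ) (E : Finset ℕ) : Prop :=
  (∀ a ∈ E, a < n) ∧ 0 ∈ E ∧ ∀ a ∈ E, ∀ b ∈ E, a + b < n → a + b ∈ E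

/-- `G` generates `E` as a partial monoid inside `[0, n-1]`: `G` is contained in `E`, and every
sub-partial-monoid of `[0, n-1]` that contains `G` contains `E`. -/
def Generates (n : ℕ) (G E : Finset ℕ) : Prop :=
  G ⊆ E ∧ ∀ F : Finset ℕ, IsSubPartialMonoid n F → G ⊆ F → E ⊆ F

/-- `d(E)`: the minimal number of generators of the sub-partial-monoid `E` of `[0, n-1]`. -/
noncomputable def dInv (n : ℕ) (E : Finset ℕ) : ℕ :=
  sInf {k : ℕ | ∃ G : Finset ℕ, Generates n G E ∧ G.card = k}

/-- `e_n(E)`: it is `0` for `n = 1`; for `n > 1` it is `e_{n-1}(E \ {n-1})` if `n - 1 ∈ E`, and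
`d(E) + e_{n-1}(E)` if `n - 1 ∉ E`. (The value at `n = 0` is irrelevant.) -/
noncomputable def eInv : ℕ → Finset ℕ → ℕ
  | 0, _ => 0
  | 1, _ => 0
  | n + 2, E =>
    if n + 1 ∈ E then eInv (n + 1) (E.erase (n + 1)) else dInv (n + 2) E + eInv (n + 1) E

/-! ### Subalgebras of `K[x]/x^n` -/

/-- The truncated polynomial algebra `K[x]/x^n`. -/
abbrev Trunc (K : Type*) [Field K] (n : ℕ) : Type _ :=
  K[X] ⧸ Ideal.span {(X : K[X]) ^ n}

/-- The class of a polynomial in `K[x]/x^n`. -/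
noncomputable def toTrunc (K : Type*) [Field K] (n : ℕ) (f : K[X]) : Trunc K n :=
  Ideal.Quotient.mk (Ideal.span {(X : K[X]) ^ n}) f

open Classical in
/-- The exponent set `E(R)`: the set of valuations of the monic elements of `R`. A monic element of
valuation `i < n` is the class of a polynomial `x^i + (terms of degree > i)`. -/
noncomputable def exponents {K : Type*} [Field K] {n : ℕ} (R : Subalgebra K (Trunc K n)) :
    Finset ℕ :=
  (Finset.range n).filter fun i => ∃ g : K[X], toTrunc K n (X ^ i + X ^ (i + 1) * g) ∈ R

/-- `R` is thin: it is a local ring, and its maximal ideal `m` satisfies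
`dim_K (m / m ^ 2) = d(E(R))`. -/
def IsThin {K : Type*} [Field K] {n : ℕ} (R : Subalgebra K (Trunc K n)) : Prop :=
  ∃ _ : IsLocalRing R,
    Module.finrank K (IsLocalRing.maximalIdeal R).Cotangent = dInv n (exponents R)

/-- The members of the list `l` lie in the maximal ideal `m` of the local ring `R`, and their
classes in `m / m ^ 2` are linearly independent over `K`. -/
def IndependentModSq {K : Type*} [Field K] {n : ℕ} (R : Subalgebra K (Trunc K n))
    (l : List (Trunc K n)) : Prop :=
  ∃ _ : IsLocalRing R, ∃ y : Fin l.length → IsLocalRing.maximalIdeal R,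
    (∀ i, ((y i : R) : Trunc K n) = l.get i) ∧
    LinearIndependent K fun i => (IsLocalRing.maximalIdeal R).toCotangent (y i)

/-! ### The tables -/

/-- A row of a table: the exponent set `E`, the number `e`, and the list of algebra generators,
which depend on `e` parameters `p 0, p 1, …` in `K` (the letters `a, b, c, …`). A generator is
given as `(i, [(k₁, j₁), (k₂, j₂), …])`, which stands for `x^i + p k₁ * x^j₁ + p k₂ * x^j₂ + ⋯`.
For example `(4, [(0,6), (2,7)])` is `x^4 + a x^6 + c x^7`. The full algebra `K[x]/x^n` (for
`n > 1`) is entered through its generator `x`, and the algebra `K` through the empty list. -/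
structure Row where
  E : Finset ℕ
  e : ℕ
  gens : List (ℕ × List (Fin e × ℕ))

/-- The algebra generators of a row, for the parameters `p`, as elements of `K[x]/x^n`. -/
noncomputable def Row.generators (r : Row) (K : Type*) [Field K] (n : ℕ) (p : Fin r.e → K) :
    List (Trunc K n) :=
  r.gens.map fun g => toTrunc K n (X ^ g.1 + (g.2.map fun t => C (p t.1) * X ^ t.2).sum)

/-- The subalgebra of `K[x]/x^n` that a row lists for the parameters `p`. -/
noncomputable def Row.subalgebra (r : Row) (K : Type*) [Field K] (n : ℕ) (p : Fin r.e → K) :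
    Subalgebra K (Trunc K n) :=
  Algebra.adjoin K {y | y ∈ r.generators K n p}

/-- The table for `n = 1`. -/
def table1 : List Row := [
  ⟨{0}, 0, []⟩]

/-- The table for `n = 2`. -/
def table2 : List Row := [
  ⟨{0,1}, 0, [(1, [])]⟩,
  ⟨{0}, 0, []⟩]

/-- The table for `n = 3`. -/
def table3 : List Row := [
  ⟨{0,1,2}, 0, [(1, [])]⟩,
  ⟨{0,2}, 0, [(2, [])]⟩,
  ⟨{0}, 0, []⟩]

/-- The table for `n = 4`. -/
def table4 : List Row := [
  ⟨{0,1,2,3}, 0, [(1, [])]⟩,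
  ⟨{0,2,3}, 0, [(2, []), (3, [])]⟩,
  ⟨{0,3}, 0, [(3, [])]⟩,
  ⟨{0,2}, 1, [(2, [(0,3)])]⟩,
  ⟨{0}, 0, []⟩]

/-- The table for `n = 5`. -/
def table5 : List Row := [
  ⟨{0,1,2,3,4}, 0, [(1, [])]⟩,
  ⟨{0,2,3,4}, 0, [(2, []), (3, [])]⟩,
  ⟨{0,3,4}, 0, [(3, []), (4, [])]⟩,
  ⟨{0,2,4}, 1, [(2, [(0,3)])]⟩,
  ⟨{0,4}, 0, [(4, [])]⟩,
  ⟨{0,3}, 1, [(3, [(0,4)])]⟩,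
  ⟨{0}, 0, []⟩]

/-- The table for `n = 6`. -/
def table6 : List Row := [
  ⟨{0,1,2,3,4,5}, 0, [(1, [])]⟩,
  ⟨{0,2,3,4,5}, 0, [(2, []), (3, [])]⟩,
  ⟨{0,3,4,5}, 0, [(3, []), (4, []), (5, [])]⟩,
  ⟨{0,2,4,5}, 1, [(2, [(0,3)]), (5, [])]⟩,
  ⟨{0,4,5}, 0, [(4, []), (5, [])]⟩,
  ⟨{0,3,5}, 1, [(3, [(0,4)]), (5, [])]⟩,
  ⟨{0,5}, 0, [(5, [])]⟩,
  ⟨{0,3,4}, 2, [(3, [(0,5)]), (4, [(1,5)])]⟩,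
  ⟨{0,2,4}, 2, [(2, [(0,3), (1,5)])]⟩,
  ⟨{0,4}, 1, [(4, [(0,5)])]⟩,
  ⟨{0,3}, 2, [(3, [(0,4), (1,5)])]⟩,
  ⟨{0}, 0, []⟩]

/-- The table for `n = 7`. -/
def table7 : List Row := [
  ⟨{0,1,2,3,4,5,6}, 0, [(1, [])]⟩,
  ⟨{0,2,3,4,5,6}, 0, [(2, []), (3, [])]⟩,
  ⟨{0,3,4,5,6}, 0, [(3, []), (4, []), (5, [])]⟩,
  ⟨{0,2,4,5,6}, 1, [(2, [(0,3)]), (5, [])]⟩,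
  ⟨{0,4,5,6}, 0, [(4, []), (5, []), (6, [])]⟩,
  ⟨{0,3,5,6}, 1, [(3, [(0,4)]), (5, [])]⟩,
  ⟨{0,5,6}, 0, [(5, []), (6, [])]⟩,
  ⟨{0,3,4,6}, 2, [(3, [(0,5)]), (4, [(1,5)])]⟩,
  ⟨{0,2,4,6}, 2, [(2, [(0,3), (1,5)])]⟩,
  ⟨{0,4,6}, 1, [(4, [(0,5)]), (6, [])]⟩,
  ⟨{0,3,6}, 2, [(3, [(0,4), (1,5)])]⟩,
  ⟨{0,6}, 0, [(6, [])]⟩,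
  ⟨{0,4,5}, 2, [(4, [(0,6)]), (5, [(1,6)])]⟩,
  ⟨{0,5}, 1, [(5, [(0,6)])]⟩,
  ⟨{0,4}, 2, [(4, [(0,5), (1,6)])]⟩,
  ⟨{0}, 0, []⟩]

/-- The table for `n = 8`. -/
def table8 : List Row := [
  ⟨{0,1,2,3,4,5,6,7}, 0, [(1, [])]⟩,
  ⟨{0,2,3,4,5,6,7}, 0, [(2, []), (3, [])]⟩,
  ⟨{0,3,4,5,6,7}, 0, [(3, []), (4, []), (5, [])]⟩,
  ⟨{0,2,4,5,6,7}, 1, [(2, [(0,3)]), (5, [])]⟩,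
  ⟨{0,4,5,6,7}, 0, [(4, []), (5, []), (6, []), (7, [])]⟩,
  ⟨{0,3,5,6,7}, 1, [(3, [(0,4)]), (5, []), (7, [])]⟩,
  ⟨{0,5,6,7}, 0, [(5, []), (6, []), (7, [])]⟩,
  ⟨{0,3,4,6,7}, 2, [(3, [(0,5)]), (4, [(1,5)])]⟩,
  ⟨{0,2,4,6,7}, 2, [(2, [(0,3), (1,5)]), (7, [])]⟩,
  ⟨{0,4,6,7}, 1, [(4, [(0,5)]), (6, []), (7, [])]⟩,
  ⟨{0,3,6,7}, 2, [(3, [(0,4), (1,5)]), (7, [])]⟩,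
  ⟨{0,6,7}, 0, [(6, []), (7, [])]⟩,
  ⟨{0,4,5,7}, 2, [(4, [(0,6)]), (5, [(1,6)]), (7, [])]⟩,
  ⟨{0,5,7}, 1, [(5, [(0,6)]), (7, [])]⟩,
  ⟨{0,4,7}, 2, [(4, [(0,5), (1,6)]), (7, [])]⟩,
  ⟨{0,7}, 0, [(7, [])]⟩,
  ⟨{0,4,5,6}, 3, [(4, [(0,7)]), (5, [(1,7)]), (6, [(2,7)])]⟩,
  ⟨{0,3,5,6}, 3, [(3, [(0,4), (1,7)]), (5, [(2,7)])]⟩,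
  ⟨{0,5,6}, 2, [(5, [(0,7)]), (6, [(1,7)])]⟩,
  ⟨{0,2,4,6}, 3, [(2, [(0,3), (1,5), (2,7)])]⟩,
  ⟨{0,4,6}, 3, [(4, [(0,5), (1,7)]), (6, [(2,7)])]⟩,
  ⟨{0,3,6}, 3, [(3, [(0,4), (1,5), (2,7)])]⟩,
  ⟨{0,6}, 1, [(6, [(0,7)])]⟩,
  ⟨{0,4,5}, 4, [(4, [(0,6), (2,7)]), (5, [(1,6), (3,7)])]⟩,
  ⟨{0,5}, 2, [(5, [(0,6), (1,7)])]⟩,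
  ⟨{0,4}, 3, [(4, [(0,5), (1,6), (2,7)])]⟩,
  ⟨{0}, 0, []⟩]

/-- The table for `n = 9`. -/
def table9 : List Row := [
  ⟨{0,1,2,3,4,5,6,7,8}, 0, [(1, [])]⟩,
  ⟨{0,2,3,4,5,6,7,8}, 0, [(2, []), (3, [])]⟩,
  ⟨{0,3,4,5,6,7,8}, 0, [(3, []), (4, []), (5, [])]⟩,
  ⟨{0,2,4,5,6,7,8}, 1, [(2, [(0,3)]), (5, [])]⟩,
  ⟨{0,4,5,6,7,8}, 0, [(4, []), (5, []), (6, []), (7, [])]⟩,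
  ⟨{0,3,5,6,7,8}, 1, [(3, [(0,4)]), (5, []), (7, [])]⟩,
  ⟨{0,5,6,7,8}, 0, [(5, []), (6, []), (7, []), (8, [])]⟩,
  ⟨{0,3,4,6,7,8}, 2, [(3, [(0,5)]), (4, [(1,5)])]⟩,
  ⟨{0,2,4,6,7,8}, 2, [(2, [(0,3), (1,5)]), (7, [])]⟩,
  ⟨{0,4,6,7,8}, 1, [(4, [(0,5)]), (6, []), (7, [])]⟩,
  ⟨{0,3,6,7,8}, 2, [(3, [(0,4), (1,5)]), (7, []), (8, [])]⟩,
  ⟨{0,6,7,8}, 0, [(6, []), (7, []), (8, [])]⟩,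
  ⟨{0,4,5,7,8}, 2, [(4, [(0,6)]), (5, [(1,6)]), (7, [])]⟩,
  ⟨{0,5,7,8}, 1, [(5, [(0,6)]), (7, []), (8, [])]⟩,
  ⟨{0,4,7,8}, 2, [(4, [(0,5), (1,6)]), (7, [])]⟩,
  ⟨{0,7,8}, 0, [(7, []), (8, [])]⟩,
  ⟨{0,4,5,6,8}, 3, [(4, [(0,7)]), (5, [(1,7)]), (6, [(2,7)])]⟩,
  ⟨{0,3,5,6,8}, 3, [(3, [(0,4), (1,7)]), (5, [(2,7)])]⟩,
  ⟨{0,5,6,8}, 2, [(5, [(0,7)]), (6, [(1,7)]), (8, [])]⟩,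
  ⟨{0,2,4,6,8}, 3, [(2, [(0,3), (1,5), (2,7)])]⟩,
  ⟨{0,4,6,8}, 3, [(4, [(0,5), (1,7)]), (6, [(2,7)])]⟩,
  ⟨{0,3,6,8}, 3, [(3, [(0,4), (1,5), (2,7)]), (8, [])]⟩,
  ⟨{0,6,8}, 1, [(6, [(0,7)]), (8, [])]⟩,
  ⟨{0,4,5,8}, 4, [(4, [(0,6), (2,7)]), (5, [(1,6), (3,7)])]⟩,
  ⟨{0,5,8}, 2, [(5, [(0,6), (1,7)]), (8, [])]⟩,
  ⟨{0,4,8}, 3, [(4, [(0,5), (1,6), (2,7)])]⟩,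
  ⟨{0,8}, 0, [(8, [])]⟩,
  ⟨{0,5,6,7}, 3, [(5, [(0,8)]), (6, [(1,8)]), (7, [(2,8)])]⟩,
  ⟨{0,3,6,7}, 4, [(3, [(0,4), (1,5), (2,8)]), (7, [(3,8)])]⟩,
  ⟨{0,6,7}, 2, [(6, [(0,8)]), (7, [(1,8)])]⟩,
  ⟨{0,5,7}, 3, [(5, [(0,6), (1,8)]), (7, [(2,8)])]⟩,
  ⟨{0,7}, 1, [(7, [(0,8)])]⟩,
  ⟨{0,5,6}, 4, [(5, [(0,7), (2,8)]), (6, [(1,7), (3,8)])]⟩,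
  ⟨{0,3,6}, 4, [(3, [(0,4), (1,5), (2,7), (3,8)])]⟩,
  ⟨{0,6}, 2, [(6, [(0,7), (1,8)])]⟩,
  ⟨{0,5}, 3, [(5, [(0,6), (1,7), (2,8)])]⟩,
  ⟨{0}, 0, []⟩]

/-- The table for `n = 10`. -/
def table10 : List Row := [
  ⟨{0,1,2,3,4,5,6,7,8,9}, 0, [(1, [])]⟩,
  ⟨{0,2,3,4,5,6,7,8,9}, 0, [(2, []), (3, [])]⟩,
  ⟨{0,3,4,5,6,7,8,9}, 0, [(3, []), (4, []), (5, [])]⟩,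
  ⟨{0,2,4,5,6,7,8,9}, 1, [(2, [(0,3)]), (5, [])]⟩,
  ⟨{0,4,5,6,7,8,9}, 0, [(4, []), (5, []), (6, []), (7, [])]⟩,
  ⟨{0,3,5,6,7,8,9}, 1, [(3, [(0,4)]), (5, []), (7, [])]⟩,
  ⟨{0,5,6,7,8,9}, 0, [(5, []), (6, []), (7, []), (8, []), (9, [])]⟩,
  ⟨{0,3,4,6,7,8,9}, 2, [(3, [(0,5)]), (4, [(1,5)])]⟩,
  ⟨{0,2,4,6,7,8,9}, 2, [(2, [(0,3), (1,5)]), (7, [])]⟩,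
  ⟨{0,4,6,7,8,9}, 1, [(4, [(0,5)]), (6, []), (7, []), (9, [])]⟩,
  ⟨{0,3,6,7,8,9}, 2, [(3, [(0,4), (1,5)]), (7, []), (8, [])]⟩,
  ⟨{0,6,7,8,9}, 0, [(6, []), (7, []), (8, []), (9, [])]⟩,
  ⟨{0,4,5,7,8,9}, 2, [(4, [(0,6)]), (5, [(1,6)]), (7, [])]⟩,
  ⟨{0,5,7,8,9}, 1, [(5, [(0,6)]), (7, []), (8, []), (9, [])]⟩,
  ⟨{0,4,7,8,9}, 2, [(4, [(0,5), (1,6)]), (7, []), (9, [])]⟩,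
  ⟨{0,7,8,9}, 0, [(7, []), (8, []), (9, [])]⟩,
  ⟨{0,4,5,6,8,9}, 3, [(4, [(0,7)]), (5, [(1,7)]), (6, [(2,7)])]⟩,
  ⟨{0,3,5,6,8,9}, 3, [(3, [(0,4), (1,7)]), (5, [(2,7)])]⟩,
  ⟨{0,5,6,8,9}, 2, [(5, [(0,7)]), (6, [(1,7)]), (8, []), (9, [])]⟩,
  ⟨{0,2,4,6,8,9}, 3, [(2, [(0,3), (1,5), (2,7)]), (9, [])]⟩,
  ⟨{0,4,6,8,9}, 3, [(4, [(0,5), (1,7)]), (6, [(2,7)]), (9, [])]⟩,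
  ⟨{0,3,6,8,9}, 3, [(3, [(0,4), (1,5), (2,7)]), (8, [])]⟩,
  ⟨{0,6,8,9}, 1, [(6, [(0,7)]), (8, []), (9, [])]⟩,
  ⟨{0,4,5,8,9}, 4, [(4, [(0,6), (2,7)]), (5, [(1,6), (3,7)])]⟩,
  ⟨{0,5,8,9}, 2, [(5, [(0,6), (1,7)]), (8, []), (9, [])]⟩,
  ⟨{0,4,8,9}, 3, [(4, [(0,5), (1,6), (2,7)]), (9, [])]⟩,
  ⟨{0,8,9}, 0, [(8, []), (9, [])]⟩,
  ⟨{0,5,6,7,9}, 3, [(5, [(0,8)]), (6, [(1,8)]), (7, [(2,8)]), (9, [])]⟩,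
  ⟨{0,3,6,7,9}, 4, [(3, [(0,4), (1,5), (2,8)]), (7, [(3,8)])]⟩,
  ⟨{0,6,7,9}, 2, [(6, [(0,8)]), (7, [(1,8)]), (9, [])]⟩,
  ⟨{0,5,7,9}, 3, [(5, [(0,6), (1,8)]), (7, [(2,8)]), (9, [])]⟩,
  ⟨{0,7,9}, 1, [(7, [(0,8)]), (9, [])]⟩,
  ⟨{0,5,6,9}, 4, [(5, [(0,7), (2,8)]), (6, [(1,7), (3,8)]), (9, [])]⟩,
  ⟨{0,3,6,9}, 4, [(3, [(0,4), (1,5), (2,7), (3,8)])]⟩,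
  ⟨{0,6,9}, 2, [(6, [(0,7), (1,8)]), (9, [])]⟩,
  ⟨{0,5,9}, 3, [(5, [(0,6), (1,7), (2,8)]), (9, [])]⟩,
  ⟨{0,9}, 0, [(9, [])]⟩,
  ⟨{0,5,6,7,8}, 4, [(5, [(0,9)]), (6, [(1,9)]), (7, [(2,9)]), (8, [(3,9)])]⟩,
  ⟨{0,4,6,7,8}, 4, [(4, [(0,5), (1,9)]), (6, [(2,9)]), (7, [(3,9)])]⟩,
  ⟨{0,6,7,8}, 3, [(6, [(0,9)]), (7, [(1,9)]), (8, [(2,9)])]⟩,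
  ⟨{0,5,7,8}, 4, [(5, [(0,6), (1,9)]), (7, [(2,9)]), (8, [(3,9)])]⟩,
  ⟨{0,4,7,8}, 4, [(4, [(0,5), (1,6), (2,9)]), (7, [(3,9)])]⟩,
  ⟨{0,7,8}, 2, [(7, [(0,9)]), (8, [(1,9)])]⟩,
  ⟨{0,5,6,8}, 5, [(5, [(0,7), (2,9)]), (6, [(1,7), (3,9)]), (8, [(4,9)])]⟩,
  ⟨{0,2,4,6,8}, 4, [(2, [(0,3), (1,5), (2,7), (3,9)])]⟩,
  ⟨{0,4,6,8}, 5, [(4, [(0,5), (1,7), (3,9)]), (6, [(2,7), (4,9)])]⟩,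
  ⟨{0,6,8}, 3, [(6, [(0,7), (1,9)]), (8, [(2,9)])]⟩,
  ⟨{0,5,8}, 4, [(5, [(0,6), (1,7), (2,9)]), (8, [(3,9)])]⟩,
  ⟨{0,4,8}, 4, [(4, [(0,5), (1,6), (2,7), (3,9)])]⟩,
  ⟨{0,8}, 1, [(8, [(0,9)])]⟩,
  ⟨{0,5,6,7}, 6, [(5, [(0,8), (3,9)]), (6, [(1,8), (4,9)]), (7, [(2,8), (5,9)])]⟩,
  ⟨{0,6,7}, 4, [(6, [(0,8), (2,9)]), (7, [(1,8), (3,9)])]⟩,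
  ⟨{0,5,7}, 5, [(5, [(0,6), (1,8), (3,9)]), (7, [(2,8), (4,9)])]⟩,
  ⟨{0,7}, 2, [(7, [(0,8), (1,9)])]⟩,
  ⟨{0,5,6}, 6, [(5, [(0,7), (2,8), (4,9)]), (6, [(1,7), (3,8), (5,9)])]⟩,
  ⟨{0,6}, 3, [(6, [(0,7), (1,8), (2,9)])]⟩,
  ⟨{0,5}, 4, [(5, [(0,6), (1,7), (2,8), (3,9)])]⟩,
  ⟨{0}, 0, []⟩]

/-- The table for `K[x]/x^n`, for `1 ≤ n ≤ 10`. -/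
def table : ℕ → List Row
  | 1 => table1
  | 2 => table2
  | 3 => table3
  | 4 => table4
  | 5 => table5
  | 6 => table6
  | 7 => table7
  | 8 => table8
  | 9 => table9
  | 10 => table10
  | _ => []

end TruncSubalg

/-!
A subalgebra `R` of `K[x]/x^n` contains, for each `i` in its exponent set `E`, exactly one *reduced*
element: a monic element of valuation `i` without further terms whose exponents lie in `E`
(`exists_reduced`, `eq_zero_of_cf_exponents`). The entries of a table row are the reduced elements
for the irreducible elements `g` of `E`, with one letter for each gap `j > g` of `E`. So the letters
can be recovered from the algebra, and a subalgebra with exponent set `E` contains the algebra of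
the row for exactly one choice of the letters. Since a subalgebra is determined by its exponent set
inside any larger subalgebra (`eq_of_le_of_exponents_subset`), it remains to see that the algebra of
the row has no exponents outside `E`.

For this, the algebra is given a *monomial basis*: monic elements `b i`, `i ∈ E`, with
`b i * b j = b (i + j)` (`IsMonomialBasis`). For `n ≤ 10` there are two cases. Either the
irreducible elements of `E` have no two different sums of the same value below `n`; then `b i` is
the product of generators given by the decomposition of `i`, whatever the letters are. Or there are
no letters at all, and `b i = x^i`. Products of total degree at least `n` vanish, so the span of the
`b i` is a subalgebra, its exponent set is `E`, and it is generated by the `b g` with `g`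
irreducible. The maximal ideal is spanned by the `b i` with `i ≠ 0` and its square by those with `i`
a sum of two nonzero elements of `E`; hence the classes of the `b g` form a basis of the cotangent
space, whose dimension is the number of irreducible elements. That number is `d(E)`, because the
irreducible elements are the least generating set of `E` (`dInv_eq_card`).

What is left is a finite check of the tables (`Row.IsValid`, `nodup_table`, `tableStep`), done by
evaluation. Completeness of the list of sub-partial-monoids is an induction on `n`: removing `n`
from a sub-partial-monoid of `[0, n]` leaves one of `[0, n - 1]`.
-/

namespace TruncSubalg

/-! ### Irreducible elements of a partial monoid -/

/-- The nonzero elements of `E` that are not a sum of two nonzero elements of `E`. -/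
def irreducibles (E : Finset ℕ) : Finset ℕ :=
  E.filter fun a => a ≠ 0 ∧ ∀ b ∈ E, ∀ c ∈ E, b + c = a → b = 0 ∨ c = 0

theorem mem_irreducibles {E : Finset ℕ} {a : ℕ} :
    a ∈ irreducibles E ↔ a ∈ E ∧ a ≠ 0 ∧ ∀ b ∈ E, ∀ c ∈ E, b + c = a → b = 0 ∨ c = 0 := by
  simp [irreducibles]

theorem exists_add_of_notMem_irreducibles {E : Finset ℕ} {a : ℕ} (ha : a ∈ E) (h0 : a ≠ 0)
    (h : a ∉ irreducibles E) : ∃ b ∈ E, ∃ c ∈ E, b + c = a ∧ b ≠ 0 ∧ c ≠ 0 := by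
  rw [mem_irreducibles] at h
  push Not at h
  obtain ⟨b, hb, c, hc, h1, h2⟩ := h ha h0
  exact ⟨b, hb, c, hc, h1, h2⟩

theorem generates_irreducibles {n : ℕ} {E : Finset ℕ} (hE : IsSubPartialMonoid n E) :
    Generates n (irreducibles E) E := by
  refine ⟨Finset.filter_subset _ _, fun F hF hG a => ?_⟩
  induction a using Nat.strong_induction_on with
  | _ a ih =>
    intro ha
    by_cases h0 : a = 0
    · exact h0 ▸ hF.2.1
    by_cases hi : a ∈ irreducibles E
    · exact hG hi
    obtain ⟨b, hb, c, hc, rfl, hb0, hc0⟩ := exists_add_of_notMem_irreducibles ha h0 hi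
    exact hF.2.2 b (ih b (by omega) hb) c (ih c (by omega) hc) (hE.1 _ ha)

/-- An irreducible element belongs to every generating set, because removing it from `E` leaves a
sub-partial-monoid. -/
theorem irreducibles_subset_of_generates {n : ℕ} {E G : Finset ℕ} (hE : IsSubPartialMonoid n E)
    (hG : Generates n G E) : irreducibles E ⊆ G := by
  intro a ha
  obtain ⟨haE, ha0, hirr⟩ := mem_irreducibles.1 ha
  by_contra haG
  have hF : IsSubPartialMonoid n (E.erase a) := by
    refine ⟨fun b hb => hE.1 b (Finset.mem_of_mem_erase hb),
      Finset.mem_erase.2 ⟨ha0.symm, hE.2.1⟩, fun b hb c hc hbc => ?_⟩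
    rw [Finset.mem_erase] at hb hc ⊢
    refine ⟨fun h => ?_, hE.2.2 b hb.2 c hc.2 hbc⟩
    rcases hirr b hb.2 c hc.2 h with h0 | h0
    · exact hc.1 (by omega)
    · exact hb.1 (by omega)
  have h := hG.2 _ hF (fun b hb => Finset.mem_erase.2 ⟨fun h => haG (h ▸ hb), hG.1 hb⟩) haE
  simp at h

theorem dInv_eq_card {n : ℕ} {E : Finset ℕ} (hE : IsSubPartialMonoid n E) :
    dInv n E = (irreducibles E).card := by
  apply le_antisymm
  · exact Nat.sInf_le ⟨_, generates_irreducibles hE, rfl⟩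
  · refine le_csInf ⟨(irreducibles E).card, _, generates_irreducibles hE, rfl⟩ ?_
    rintro k ⟨G, hG, rfl⟩
    exact Finset.card_le_card (irreducibles_subset_of_generates hE hG)

/-- The recursion of `eInv` with the number of irreducible elements in the place of `dInv`, which
can be evaluated. -/
def eCount : ℕ → Finset ℕ → ℕ
  | 0, _ => 0
  | 1, _ => 0
  | n + 2, E =>
    if n + 1 ∈ E then eCount (n + 1) (E.erase (n + 1))
    else (irreducibles E).card + eCount (n + 1) E

theorem IsSubPartialMonoid.erase_last {n : ℕ} {E : Finset ℕ}
    (hE : IsSubPartialMonoid (n + 2) E) : IsSubPartialMonoid (n + 1) (E.erase (n + 1)) := by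
  refine ⟨fun a ha => ?_, Finset.mem_erase.2 ⟨by omega, hE.2.1⟩, fun a ha b hb hab => ?_⟩
  · rw [Finset.mem_erase] at ha
    have := hE.1 a ha.2
    omega
  · rw [Finset.mem_erase] at ha hb ⊢
    exact ⟨by omega, hE.2.2 a ha.2 b hb.2 (by omega)⟩

theorem eInv_eq_eCount (n : ℕ) (E : Finset ℕ) (hE : IsSubPartialMonoid n E) :
    eInv n E = eCount n E := by
  induction n, E using eCount.induct with
  | case1 => rfl
  | case2 => rfl
  | case3 n E h ih => rw [eInv, eCount, if_pos h, if_pos h, ih hE.erase_last]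
  | case4 n E h ih =>
    have := hE.erase_last
    rw [Finset.erase_eq_of_notMem h] at this
    rw [eInv, eCount, if_neg h, if_neg h, ih this, dInv_eq_card hE]

/-! ### Checking the combinatorial content of the tables -/

instance (n : ℕ) (E : Finset ℕ) : Decidable (IsSubPartialMonoid n E) := by
  unfold IsSubPartialMonoid; infer_instance

/-- The tables are closed under the extension of a sub-partial-monoid of `[0, n - 1]` to `[0, n]`,
with or without the new element `n`. -/
def TableStep (n : ℕ) : Prop :=
  ∀ r ∈ table n, (∃ s ∈ table (n + 1), s.E = insert n r.E) ∧
    ((∃ s ∈ table (n + 1), s.E = r.E) ∨ ∃ a ∈ r.E, ∃ b ∈ r.E, a + b = n)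

instance (n : ℕ) : Decidable (TableStep n) := by unfold TableStep; infer_instance

theorem tableStep : ∀ n ∈ Finset.Icc 1 9, TableStep n := by decide +kernel

theorem mem_table {n : ℕ} (hn1 : 1 ≤ n) (hn10 : n ≤ 10) {E : Finset ℕ}
    (hE : IsSubPartialMonoid n E) : ∃ r ∈ table n, r.E = E := by
  induction n, hn1 using Nat.le_induction generalizing E with
  | base =>
    refine ⟨⟨{0}, 0, []⟩, by simp [table, table1], ?_⟩
    ext a
    have h1 := hE.1 a
    have h2 := hE.2.1
    simp only [Finset.mem_singleton]
    exact ⟨fun h => h ▸ h2, fun h => by have := h1 h; omega⟩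
  | succ n hn1 ih =>
    obtain ⟨m, rfl⟩ : ∃ m, n = m + 1 := ⟨n - 1, by omega⟩
    obtain ⟨r, hr, hrE⟩ := ih (by omega) hE.erase_last
    obtain ⟨h1, h2⟩ := tableStep (m + 1) (by simp; omega) r hr
    rw [hrE] at h1 h2
    by_cases hm : m + 1 ∈ E
    · rwa [Finset.insert_erase hm] at h1
    · rw [Finset.erase_eq_of_notMem hm] at h2
      refine h2.resolve_right ?_
      rintro ⟨a, ha, b, hb, hab⟩
      exact hm (hab ▸ hE.2.2 a ha b hb (by omega))

theorem nodup_table : ∀ n ∈ Finset.Icc 1 10, ((table n).map Row.E).Nodup := by decide +kernel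

/-- A decomposition of `i` into elements of the list `l`, found greedily: the first element of `l`
that leaves a remainder in `E` is split off. The first argument bounds the number of summands. -/
def decompose (l : List ℕ) (E : Finset ℕ) : ℕ → ℕ → List ℕ
  | 0, _ => []
  | m + 1, i =>
    if i = 0 then [] else
      match l.find? fun g => g ≤ i ∧ i - g ∈ E with
      | none => []
      | some g => g :: decompose l E m (i - g)

/-- The exponents of the generators of a row. -/
def Row.degrees (r : Row) : List ℕ := r.gens.map Prod.fst

/-- Sums of irreducible elements of `E` that stay below `n` determine their summands; this is
expressed by a decomposition of each `i ∈ E` that is additive in `i`. -/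
def Row.IsFree (r : Row) (n : ℕ) : Prop :=
  (∀ i ∈ r.E, (∀ g ∈ decompose r.degrees r.E n i, g ∈ r.degrees) ∧
    (decompose r.degrees r.E n i).sum = i) ∧
  (∀ g ∈ r.degrees, decompose r.degrees r.E n g = [g]) ∧
  ∀ i ∈ r.E, ∀ j ∈ r.E, i + j < n →
    (decompose r.degrees r.E n i ++ decompose r.degrees r.E n j).Perm
      (decompose r.degrees r.E n (i + j))

instance (r : Row) (n : ℕ) : Decidable (r.IsFree n) := by unfold Row.IsFree; infer_instance

/-- The combinatorial content of a row: the generators are indexed by the irreducible elements `g`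
of `E`, the generator of exponent `g` has one letter for each gap `j > g` of `E`, each letter occurs
exactly once, and either there are no letters or `E` is free. -/
structure Row.IsValid (r : Row) (n : ℕ) : Prop where
  monoid : IsSubPartialMonoid n r.E
  eCount_eq : eCount n r.E = r.e
  degrees_nodup : r.degrees.Nodup
  degrees_toFinset : r.degrees.toFinset = irreducibles r.E
  gaps : ∀ g ∈ r.gens, g.2.map Prod.snd = (List.range n).filter fun j => g.1 < j ∧ j ∉ r.E
  letters_nodup : (r.gens.flatMap fun g => g.2.map Prod.fst).Nodup
  letters_complete : ∀ k : Fin r.e, k ∈ r.gens.flatMap fun g => g.2.map Prod.fst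
  free : r.e = 0 ∨ r.IsFree n

instance (r : Row) (n : ℕ) : Decidable (r.IsValid n) :=
  decidable_of_iff
    (IsSubPartialMonoid n r.E ∧ eCount n r.E = r.e ∧ r.degrees.Nodup ∧
      r.degrees.toFinset = irreducibles r.E ∧
      (∀ g ∈ r.gens, g.2.map Prod.snd = (List.range n).filter fun j => g.1 < j ∧ j ∉ r.E) ∧
      (r.gens.flatMap fun g => g.2.map Prod.fst).Nodup ∧
      (∀ k : Fin r.e, k ∈ r.gens.flatMap fun g => g.2.map Prod.fst) ∧ (r.e = 0 ∨ r.IsFree n))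
    ⟨fun ⟨a, b, c, d, e, f, g, h⟩ => ⟨a, b, c, d, e, f, g, h⟩,
      fun ⟨a, b, c, d, e, f, g, h⟩ => ⟨a, b, c, d, e, f, g, h⟩⟩

theorem isValid_of_mem_table : ∀ n ∈ Finset.Icc 1 10, ∀ r ∈ table n, r.IsValid n := by
  decide +kernel

/-! ### Coefficients and valuations in `K[x]/x^n` -/

variable {K : Type*} [Field K] {n : ℕ}

/-- The coefficient of `x^i` of an element of `K[x]/x^n`; it is `0` for `i ≥ n`. -/
noncomputable def cf (i : ℕ) : Trunc K n →ₗ[K] K :=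
  Submodule.liftQ ((Ideal.span {(X : K[X]) ^ n}).restrictScalars K)
    (if i < n then lcoeff K i else 0) (by
      intro f hf
      obtain ⟨g, rfl⟩ := Ideal.mem_span_singleton.1 hf
      rw [LinearMap.mem_ker]
      split_ifs with h
      · simp [coeff_X_pow_mul', h]
      · simp)

theorem cf_toTrunc (i : ℕ) (f : K[X]) :
    cf i (toTrunc K n f) = if i < n then f.coeff i else 0 := by
  change (if i < n then lcoeff K i else 0) f = _
  split_ifs <;> simp

theorem toTrunc_surjective : Function.Surjective (toTrunc K n) := Ideal.Quotient.mk_surjective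

theorem cf_of_le {i : ℕ} (h : n ≤ i) (a : Trunc K n) : cf i a = 0 := by
  obtain ⟨f, rfl⟩ := toTrunc_surjective a
  rw [cf_toTrunc, if_neg (by omega)]

theorem eq_zero_of_cf {a : Trunc K n} (h : ∀ i < n, cf i a = 0) : a = 0 := by
  obtain ⟨f, rfl⟩ := toTrunc_surjective a
  refine Ideal.Quotient.eq_zero_iff_mem.2 (Ideal.mem_span_singleton.2 (X_pow_dvd_iff.2 ?_))
  intro i hi
  simpa [cf_toTrunc, hi] using h i hi

theorem cf_mul {i : ℕ} (hi : i < n) (a b : Trunc K n) :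
    cf i (a * b) = ∑ x ∈ Finset.HasAntidiagonal.antidiagonal i, cf x.1 a * cf x.2 b := by
  obtain ⟨f, rfl⟩ := toTrunc_surjective a
  obtain ⟨g, rfl⟩ := toTrunc_surjective b
  have : toTrunc K n f * toTrunc K n g = toTrunc K n (f * g) := (map_mul _ f g).symm
  rw [this, cf_toTrunc, if_pos hi, coeff_mul]
  refine Finset.sum_congr rfl fun x hx => ?_
  rw [Finset.HasAntidiagonal.mem_antidiagonal] at hx
  rw [cf_toTrunc, cf_toTrunc, if_pos (by omega), if_pos (by omega)]

theorem cf_one (i : ℕ) : cf i (1 : Trunc K n) = if i = 0 ∧ i < n then 1 else 0 := by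
  have : (1 : Trunc K n) = toTrunc K n 1 := (map_one _).symm
  rw [this, cf_toTrunc, coeff_one]
  split_ifs <;> simp_all

/-- All coefficients below `x^i` vanish. -/
def ValGE (i : ℕ) (a : Trunc K n) : Prop := ∀ j < i, cf j a = 0

/-- The element has the form `x^i + (terms of degree > i)`. -/
def MonicAt (i : ℕ) (a : Trunc K n) : Prop := ValGE i a ∧ cf i a = 1

theorem ValGE.eq_zero {i : ℕ} (h : n ≤ i) {a : Trunc K n} (ha : ValGE i a) : a = 0 :=
  eq_zero_of_cf fun j hj => ha j (by omega)

theorem ValGE.mul {i j : ℕ} {a b : Trunc K n} (ha : ValGE i a) (hb : ValGE j b) :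
    ValGE (i + j) (a * b) := by
  intro k hk
  rcases lt_or_ge k n with hkn | hkn
  · rw [cf_mul hkn]
    refine Finset.sum_eq_zero fun x hx => ?_
    rw [Finset.HasAntidiagonal.mem_antidiagonal] at hx
    rcases lt_or_ge x.1 i with h | h
    · rw [ha _ h, zero_mul]
    · rw [hb _ (by omega), mul_zero]
  · exact cf_of_le hkn _

theorem ValGE.pow {i : ℕ} {a : Trunc K n} (ha : ValGE i a) (m : ℕ) : ValGE (m * i) (a ^ m) := by
  induction m with
  | zero => intro j hj; omega
  | succ m ih => rw [pow_succ, Nat.succ_mul]; exact ih.mul ha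

theorem MonicAt.mul {i j : ℕ} (hij : i + j < n) {a b : Trunc K n} (ha : MonicAt i a)
    (hb : MonicAt j b) : MonicAt (i + j) (a * b) := by
  refine ⟨ha.1.mul hb.1, ?_⟩
  rw [cf_mul hij, Finset.sum_eq_single (i, j)]
  · simp [ha.2, hb.2]
  · intro x hx hne
    rw [Finset.HasAntidiagonal.mem_antidiagonal] at hx
    rcases lt_or_ge x.1 i with h | h
    · rw [ha.1 _ h, zero_mul]
    · rw [hb.1 x.2, mul_zero]
      by_contra h'
      exact hne (Prod.ext (by dsimp; omega) (by dsimp; omega))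
  · simp

theorem monicAt_one (hn : 0 < n) : MonicAt 0 (1 : Trunc K n) :=
  ⟨fun j hj => by omega, by simp [cf_one, hn]⟩

theorem monicAt_list_prod {F : ℕ → Trunc K n} (l : List ℕ) (hF : ∀ g ∈ l, MonicAt g (F g))
    (hl : l.sum < n) : MonicAt l.sum (l.map F).prod := by
  induction l with
  | nil => simpa using monicAt_one hl
  | cons g l ih =>
    simp only [List.sum_cons, List.map_cons, List.prod_cons, List.forall_mem_cons] at *
    exact hF.1.mul hl (ih hF.2 (by omega))

theorem monicAt_iff_exists {i : ℕ} (hi : i < n) (a : Trunc K n) :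
    MonicAt i a ↔ ∃ g : K[X], a = toTrunc K n (X ^ i + X ^ (i + 1) * g) := by
  constructor
  · obtain ⟨f, rfl⟩ := toTrunc_surjective a
    rintro ⟨h1, h2⟩
    have : X ^ (i + 1) ∣ f - X ^ i := by
      rw [X_pow_dvd_iff]
      intro j hj
      rcases Nat.lt_succ_iff_lt_or_eq.1 hj with h | rfl
      · have := h1 j h
        rw [cf_toTrunc, if_pos (by omega)] at this
        simp [this, coeff_X_pow, h.ne]
      · rw [cf_toTrunc, if_pos hi] at h2
        simp [h2]
    obtain ⟨g, hg⟩ := this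
    exact ⟨g, by rw [← hg]; simp⟩
  · rintro ⟨g, rfl⟩
    refine ⟨fun j hj => ?_, ?_⟩
    · rw [cf_toTrunc, if_pos (by omega)]
      simp [coeff_X_pow, coeff_X_pow_mul', hj.ne, show ¬ i + 1 ≤ j by omega]
    · rw [cf_toTrunc, if_pos hi]
      simp [coeff_X_pow_mul']

theorem mem_exponents {R : Subalgebra K (Trunc K n)} {i : ℕ} :
    i ∈ exponents R ↔ i < n ∧ ∃ a ∈ R, MonicAt i a := by
  simp only [exponents, Finset.mem_filter, Finset.mem_range]
  refine and_congr_right fun hi => ?_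
  simp only [monicAt_iff_exists hi]
  constructor
  · rintro ⟨g, hg⟩; exact ⟨_, hg, g, rfl⟩
  · rintro ⟨_, ha, g, rfl⟩; exact ⟨g, ha⟩

theorem isSubPartialMonoid_exponents (hn : 0 < n) (R : Subalgebra K (Trunc K n)) :
    IsSubPartialMonoid n (exponents R) := by
  refine ⟨fun a ha => (mem_exponents.1 ha).1,
    mem_exponents.2 ⟨hn, 1, R.one_mem, monicAt_one hn⟩, fun a ha b hb hab => ?_⟩
  obtain ⟨_, x, hx, hxa⟩ := mem_exponents.1 ha
  obtain ⟨_, y, hy, hyb⟩ := mem_exponents.1 hb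
  exact mem_exponents.2 ⟨hab, x * y, R.mul_mem hx hy, hxa.mul hab hyb⟩

/-! ### Reduced elements of a subalgebra -/

theorem mem_exponents_of_valGE {R : Subalgebra K (Trunc K n)} {i : ℕ} {a : Trunc K n} (hi : i < n)
    (ha : a ∈ R) (hv : ValGE i a) (hne : cf i a ≠ 0) : i ∈ exponents R :=
  mem_exponents.2 ⟨hi, (cf i a)⁻¹ • a, R.smul_mem ha _,
    fun j hj => by rw [map_smul, hv j hj, smul_zero], by simp [hne]⟩

theorem eq_zero_of_cf_exponents {R : Subalgebra K (Trunc K n)} {a : Trunc K n} (ha : a ∈ R)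
    (h : ∀ i ∈ exponents R, cf i a = 0) : a = 0 := by
  refine eq_zero_of_cf fun i => ?_
  induction i using Nat.strong_induction_on with
  | _ i ih =>
    intro hi
    by_contra hne
    exact hne (h i (mem_exponents_of_valGE hi ha (fun j hj => ih j hj (by omega)) hne))

/-- Every `i ∈ E(R)` is the valuation of a monic element of `R` that has no other terms with
exponents in `E(R)`. -/
theorem exists_reduced {R : Subalgebra K (Trunc K n)} {i : ℕ} (hi : i ∈ exponents R) :
    ∃ a ∈ R, MonicAt i a ∧ ∀ j ∈ exponents R, i < j → cf j a = 0 := by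
  -- The coefficients at the exponents in `E(R)` are cleared in increasing order.
  suffices ∀ m, ∃ a ∈ R, MonicAt i a ∧ ∀ j ∈ exponents R, i < j → j < m → cf j a = 0 by
    obtain ⟨a, ha, ham, h⟩ := this n
    exact ⟨a, ha, ham, fun j hj hij => h j hj hij (mem_exponents.1 hj).1⟩
  intro m
  induction m with
  | zero =>
    obtain ⟨_, a, ha, ham⟩ := mem_exponents.1 hi
    exact ⟨a, ha, ham, fun j _ _ hj => by omega⟩
  | succ m ih =>
    obtain ⟨a, ha, ham, h⟩ := ih
    by_cases hm : m ∈ exponents R ∧ i < m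
    · obtain ⟨_, b, hb, hbm⟩ := mem_exponents.1 hm.1
      refine ⟨a - cf m a • b, R.sub_mem ha (R.smul_mem hb _), ⟨fun j hj => ?_, ?_⟩, ?_⟩
      · simp [ham.1 j hj, hbm.1 j (hj.trans hm.2)]
      · simp [ham.2, hbm.1 i hm.2]
      · intro j hj hij hjm
        rcases Nat.lt_succ_iff_lt_or_eq.1 hjm with hlt | rfl
        · simp [h j hj hij hlt, hbm.1 j hlt]
        · simp [hbm.2]
    · refine ⟨a, ha, ham, fun j hj hij hjm => h j hj hij ?_⟩
      rcases Nat.lt_succ_iff_lt_or_eq.1 hjm with hlt | rfl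
      · exact hlt
      · exact absurd ⟨hj, hij⟩ hm

/-- A subalgebra is determined by its exponent set within any subalgebra that contains it. -/
theorem eq_of_le_of_exponents_subset {R S : Subalgebra K (Trunc K n)} (hle : S ≤ R)
    (h : exponents R ⊆ exponents S) : S = R := by
  refine le_antisymm hle ?_
  -- Elements of high valuation are treated first: a leading term is removed with an element of `S`.
  suffices ∀ m ≤ n, ∀ a ∈ R, ValGE (n - m) a → a ∈ S from fun a ha =>
    this n le_rfl a ha fun j hj => by omega
  intro m
  induction m with
  | zero => intro _ a _ hv; rw [hv.eq_zero (by omega)]; exact S.zero_mem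
  | succ m ih =>
    intro hm a ha hv
    have hstep : ∀ b ∈ R, ValGE (n - (m + 1)) b → cf (n - (m + 1)) b = 0 → b ∈ S := by
      intro b hb hbv hb0
      refine ih (by omega) b hb fun j hj => ?_
      rcases (show j < n - (m + 1) ∨ j = n - (m + 1) by omega) with hlt | rfl
      · exact hbv j hlt
      · exact hb0
    by_cases h0 : cf (n - (m + 1)) a = 0
    · exact hstep a ha hv h0
    · obtain ⟨_, s, hs, hsm⟩ :=
        mem_exponents.1 (h (mem_exponents_of_valGE (by omega) ha hv h0))
      have := hstep (a - cf (n - (m + 1)) a • s) (R.sub_mem ha (R.smul_mem (hle hs) _))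
        (fun j hj => by simp [hv j hj, hsm.1 j hj]) (by simp [hsm.2])
      simpa using S.add_mem this (S.smul_mem hs (cf (n - (m + 1)) a))

/-! ### Subalgebras of `K[x]/x^n` are local -/

theorem cf_zero_mul (hn : 0 < n) (a b : Trunc K n) : cf 0 (a * b) = cf 0 a * cf 0 b := by
  rw [cf_mul hn]; simp

theorem isUnit_iff_cf_zero_ne (hn : 0 < n) {R : Subalgebra K (Trunc K n)} (a : R) :
    IsUnit a ↔ cf 0 (a : Trunc K n) ≠ 0 := by
  constructor
  · rintro ⟨u, rfl⟩ h
    have h1 : cf 0 (((u * u⁻¹ : Rˣ) : R) : Trunc K n) = 0 := by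
      rw [Units.val_mul, Subalgebra.coe_mul, cf_zero_mul hn, h, zero_mul]
    simp [cf_one, hn] at h1
  · intro h
    set c := cf 0 (a : Trunc K n) with hc
    -- Nonzero constant plus nilpotent.
    have hnil : IsNilpotent (a - algebraMap K R c) := by
      refine ⟨n, Subtype.ext ?_⟩
      have hv : ValGE 1 ((a - algebraMap K R c : R) : Trunc K n) := by
        intro j hj
        obtain rfl : j = 0 := by omega
        rw [Algebra.algebraMap_eq_smul_one]
        simp [cf_one, hn, hc]
      simpa using (hv.pow n).eq_zero (by omega)
    have hu : IsUnit (algebraMap K R c) := (isUnit_iff_ne_zero.2 h).map _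
    have := hnil.isUnit_add_left_of_commute hu (Commute.all _ _)
    simpa using this

theorem isLocalRing (hn : 0 < n) (R : Subalgebra K (Trunc K n)) : IsLocalRing R := by
  have : Nontrivial R := by
    refine ⟨0, 1, fun h => ?_⟩
    have h1 : cf 0 (((1 : R) : R) : Trunc K n) = 0 := by rw [← h]; simp
    simp [cf_one, hn] at h1
  refine IsLocalRing.of_nonunits_add fun a b ha hb => ?_
  rw [mem_nonunits_iff, isUnit_iff_cf_zero_ne hn, not_not] at *
  rw [Subalgebra.coe_add, map_add, ha, hb, add_zero]

theorem mem_maximalIdeal (hn : 0 < n) {R : Subalgebra K (Trunc K n)} [IsLocalRing R] (a : R) :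
    a ∈ IsLocalRing.maximalIdeal R ↔ cf 0 (a : Trunc K n) = 0 := by
  rw [IsLocalRing.mem_maximalIdeal, mem_nonunits_iff, isUnit_iff_cf_zero_ne hn, not_not]

/-! ### Monomial bases -/

/-- A family of monic elements with valuations in `E` that multiplies like the powers of `x`. Its
span is then a subalgebra with exponent set `E`. -/
structure IsMonomialBasis (E : Finset ℕ) (b : ℕ → Trunc K n) : Prop where
  one : b 0 = 1
  monicAt : ∀ i ∈ E, MonicAt i (b i)
  mul : ∀ i ∈ E, ∀ j ∈ E, i + j < n → b i * b j = b (i + j)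

namespace IsMonomialBasis

variable {E : Finset ℕ} {b : ℕ → Trunc K n}

theorem mul_eq_zero (hb : IsMonomialBasis E b) {i j : ℕ} (hi : i ∈ E) (hj : j ∈ E)
    (hij : n ≤ i + j) : b i * b j = 0 :=
  ((hb.monicAt i hi).1.mul (hb.monicAt j hj).1).eq_zero hij

theorem coeff_eq_zero (hb : IsMonomialBasis E b) {c : ℕ → K} {k : ℕ}
    (h : ValGE k (∑ i ∈ E, c i • b i)) : ∀ i ∈ E, i < k → c i = 0 := by
  intro i
  induction i using Nat.strong_induction_on with
  | _ i ih =>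
    intro hi hik
    have h1 := h i hik
    rw [map_sum, Finset.sum_eq_single i, map_smul, (hb.monicAt i hi).2, smul_eq_mul,
      mul_one] at h1
    · exact h1
    · intro j hj hne
      rcases lt_or_gt_of_ne hne with hlt | hgt
      · rw [ih j hlt hj (by omega), zero_smul, map_zero]
      · rw [map_smul, (hb.monicAt j hj).1 i hgt, smul_zero]
    · exact fun h => absurd hi h

theorem linearIndepOn (hb : IsMonomialBasis E b) : LinearIndepOn K b (E : Set ℕ) := by
  rw [linearIndepOn_finset_iff]
  intro c hc i hi
  exact hb.coeff_eq_zero (k := i + 1) (by rw [hc]; intro j _; simp) i hi (by omega)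

theorem mem_span_of_valGE (hb : IsMonomialBasis E b) {k : ℕ} {a : Trunc K n}
    (ha : a ∈ Submodule.span K (b '' E)) (hk : ValGE k a) :
    a ∈ Submodule.span K (b '' (E.filter (k ≤ ·) : Finset ℕ)) := by
  obtain ⟨c, rfl⟩ := Submodule.mem_span_image_finset_iff_exists_fun' K |>.1 ha
  refine Submodule.sum_mem _ fun i hi => ?_
  rcases lt_or_ge i k with h | h
  · rw [hb.coeff_eq_zero hk i hi h, zero_smul]; exact Submodule.zero_mem _
  · exact Submodule.smul_mem _ _ (Submodule.subset_span ⟨i, by simp [hi, h], rfl⟩)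

/-- The span of a monomial basis, as a subalgebra. -/
noncomputable def subalgebra (hb : IsMonomialBasis E b) (hE : IsSubPartialMonoid n E) :
    Subalgebra K (Trunc K n) :=
  (Submodule.span K (b '' E)).toSubalgebra
    (Submodule.subset_span ⟨0, hE.2.1, hb.one⟩) (by
      intro x y hx hy
      have h := Submodule.mul_mem_mul hx hy
      rw [Submodule.span_mul_span] at h
      refine Submodule.span_le.2 ?_ h
      rintro _ ⟨_, ⟨i, hi, rfl⟩, _, ⟨j, hj, rfl⟩, rfl⟩
      dsimp only
      rcases lt_or_ge (i + j) n with hij | hij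
      · rw [hb.mul i hi j hj hij]
        exact Submodule.subset_span ⟨_, hE.2.2 i hi j hj hij, rfl⟩
      · rw [hb.mul_eq_zero hi hj hij]; exact Submodule.zero_mem _)

theorem mem_subalgebra (hb : IsMonomialBasis E b) (hE : IsSubPartialMonoid n E)
    {a : Trunc K n} : a ∈ hb.subalgebra hE ↔ a ∈ Submodule.span K (b '' E) := Iff.rfl

theorem subalgebra_eq_adjoin (hb : IsMonomialBasis E b) (hE : IsSubPartialMonoid n E) :
    hb.subalgebra hE = Algebra.adjoin K (b '' irreducibles E) := by
  apply le_antisymm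
  · intro a ha
    rw [mem_subalgebra] at ha
    rw [← Subalgebra.mem_toSubmodule]
    refine Submodule.span_le.2 ?_ ha
    rintro _ ⟨i, hi, rfl⟩
    induction i using Nat.strong_induction_on with
    | _ i ih =>
      by_cases h0 : i = 0
      · rw [h0, hb.one]; exact Subalgebra.one_mem _
      by_cases hirr : i ∈ irreducibles E
      · exact Algebra.subset_adjoin ⟨i, hirr, rfl⟩
      obtain ⟨j, hj, k, hk, rfl, hj0, hk0⟩ := exists_add_of_notMem_irreducibles hi h0 hirr
      rw [← hb.mul j hj k hk (hE.1 _ hi)]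
      exact Subalgebra.mul_mem _ (ih j (by omega) hj) (ih k (by omega) hk)
  · refine Algebra.adjoin_le ?_
    rintro _ ⟨i, hi, rfl⟩
    exact Submodule.subset_span ⟨i, (mem_irreducibles.1 hi).1, rfl⟩

theorem exponents_subalgebra (hb : IsMonomialBasis E b) (hE : IsSubPartialMonoid n E) :
    exponents (hb.subalgebra hE) = E := by
  ext i
  rw [mem_exponents]
  constructor
  · rintro ⟨-, a, ha, ham⟩
    by_contra hi
    have h1 := hb.mem_span_of_valGE ha ham.1
    obtain ⟨c, hc⟩ := Submodule.mem_span_image_finset_iff_exists_fun' K |>.1 h1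
    have h2 := ham.2
    rw [← hc, map_sum, Finset.sum_eq_zero] at h2
    · exact zero_ne_one h2
    · intro j hj
      rw [Finset.mem_filter] at hj
      have : i < j := lt_of_le_of_ne hj.2 fun h => hi (h ▸ hj.1)
      rw [map_smul, (hb.monicAt j hj.1).1 i this, smul_zero]
  · intro hi
    exact ⟨hE.1 i hi, b i, Submodule.subset_span ⟨i, hi, rfl⟩, hb.monicAt i hi⟩

/-! ### The cotangent space -/

/-- `Ideal.toCotangent` is linear over the base field. It is stated for a
general algebra, where the instance search is quick. -/
theorem toCotangent_smul {A : Type*} [CommRing A] [Algebra K A] (I : Ideal A) (c : K) (x : I) :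
    I.toCotangent (c • x) = c • I.toCotangent x :=
  LinearMap.map_smul_of_tower _ _ _

variable {R : Subalgebra K (Trunc K n)}

theorem mem_span_of_mem_maximalIdeal (hb : IsMonomialBasis E b) (hE : IsSubPartialMonoid n E)
    [IsLocalRing R] (hR : R = hb.subalgebra hE) {a : R}
    (ha : a ∈ IsLocalRing.maximalIdeal R) :
    (a : Trunc K n) ∈ Submodule.span K (b '' (E.erase 0 : Finset ℕ)) := by
  rw [mem_maximalIdeal (hE.1 0 hE.2.1)] at ha
  have ha' : (a : Trunc K n) ∈ hb.subalgebra hE := hR ▸ a.2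
  have h := hb.mem_span_of_valGE ha' (k := 1) fun j hj => by
    obtain rfl : j = 0 := by omega
    exact ha
  have hset : E.filter (1 ≤ ·) = E.erase 0 := by
    ext i
    rw [Finset.mem_filter, Finset.mem_erase, Nat.one_le_iff_ne_zero, and_comm]
  rwa [hset] at h

/-- The square of the maximal ideal involves only the `b i` with `i` a sum of two nonzero elements
of `E`. -/
theorem mem_span_of_mem_maximalIdeal_sq (hb : IsMonomialBasis E b) (hE : IsSubPartialMonoid n E)
    [IsLocalRing R] (hR : R = hb.subalgebra hE) {a : R}
    (ha : a ∈ IsLocalRing.maximalIdeal R ^ 2) :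
    (a : Trunc K n) ∈ Submodule.span K (b '' (E \ irreducibles E : Finset ℕ)) := by
  rw [pow_two] at ha
  refine Submodule.mul_induction_on
    (C := fun x : R => (x : Trunc K n) ∈ Submodule.span K (b '' (E \ irreducibles E : Finset ℕ)))
    ha (fun x hx y hy => ?_) fun x y hx hy => ?_
  · have h := Submodule.mul_mem_mul (hb.mem_span_of_mem_maximalIdeal hE hR hx)
      (hb.mem_span_of_mem_maximalIdeal hE hR hy)
    rw [Submodule.span_mul_span] at h
    refine Submodule.span_le.2 ?_ h
    rintro _ ⟨_, ⟨i, hi, rfl⟩, _, ⟨j, hj, rfl⟩, rfl⟩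
    dsimp only
    rw [Finset.mem_coe, Finset.mem_erase] at hi hj
    rcases lt_or_ge (i + j) n with hij | hij
    · rw [hb.mul i hi.2 j hj.2 hij]
      refine Submodule.subset_span ⟨_, ?_, rfl⟩
      rw [Finset.mem_coe, Finset.mem_sdiff, mem_irreducibles]
      refine ⟨hE.2.2 i hi.2 j hj.2 hij, fun h => ?_⟩
      rcases h.2.2 i hi.2 j hj.2 rfl with h0 | h0
      · exact hi.1 h0
      · exact hj.1 h0
    · rw [hb.mul_eq_zero hi.2 hj.2 hij]; exact Submodule.zero_mem _
  · exact Submodule.add_mem _ hx hy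

variable {ι : Type*} {d : ι → ℕ}

theorem linearIndependent_toCotangent [Finite ι] (hb : IsMonomialBasis E b)
    (hE : IsSubPartialMonoid n E) [IsLocalRing R] (hR : R = hb.subalgebra hE)
    (hd : Function.Injective d) (hdE : ∀ i, d i ∈ irreducibles E)
    (y : ι → IsLocalRing.maximalIdeal R)
    (hy : ∀ i, ((y i : R) : Trunc K n) = b (d i)) :
    LinearIndependent K fun i => (IsLocalRing.maximalIdeal R).toCotangent (y i) := by
  have := Fintype.ofFinite ι
  rw [Fintype.linearIndependent_iff]
  intro c hc
  have h1 : (IsLocalRing.maximalIdeal R).toCotangent (∑ i, c i • y i) = 0 := by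
    rw [map_sum, ← hc]
    exact Finset.sum_congr rfl fun i _ => toCotangent_smul _ _ _
  rw [Ideal.toCotangent_eq_zero] at h1
  have h2 := hb.mem_span_of_mem_maximalIdeal_sq hE hR h1
  have h3 : (((∑ i, c i • y i : IsLocalRing.maximalIdeal R) : R) : Trunc K n) =
      ∑ i, c i • b (d i) := by
    simp [hy]
  rw [h3] at h2
  have hli := hb.linearIndepOn
  have hdisj : Disjoint (Submodule.span K (b '' irreducibles E))
      (Submodule.span K (b '' (E \ irreducibles E : Finset ℕ))) := by
    have hli := hli
    rw [← Finset.union_sdiff_of_subset (Finset.filter_subset _ _ : irreducibles E ⊆ E),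
      Finset.coe_union, linearIndepOn_union_iff
        (Finset.disjoint_coe.2 Finset.disjoint_sdiff)] at hli
    exact hli.2.2
  have h4 : ∑ i, c i • b (d i) = 0 := by
    refine Submodule.disjoint_def.1 hdisj _ (Submodule.sum_mem _ fun i _ => ?_) h2
    exact Submodule.smul_mem _ _ (Submodule.subset_span ⟨_, hdE i, rfl⟩)
  have h5 : LinearIndependent K fun i => b (d i) := by
    have := hli.comp (fun i => (⟨d i, (mem_irreducibles.1 (hdE i)).1⟩ : (E : Set ℕ)))
      fun i j hij => hd (congrArg Subtype.val hij)
    exact this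
  exact Fintype.linearIndependent_iff.1 h5 c h4

theorem span_toCotangent (hb : IsMonomialBasis E b) (hE : IsSubPartialMonoid n E)
    [IsLocalRing R] (hR : R = hb.subalgebra hE) (hdE : ∀ g ∈ irreducibles E, ∃ i, d i = g)
    (y : ι → IsLocalRing.maximalIdeal R)
    (hy : ∀ i, ((y i : R) : Trunc K n) = b (d i)) :
    ⊤ ≤ Submodule.span K (Set.range fun i =>
      (IsLocalRing.maximalIdeal R).toCotangent (y i)) := by
  have hn : 0 < n := hE.1 0 hE.2.1
  have hB : ∀ i ∈ E.erase 0, ∃ B : IsLocalRing.maximalIdeal R,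
      ((B : R) : Trunc K n) = b i := by
    intro i hi
    rw [Finset.mem_erase] at hi
    refine ⟨⟨⟨b i, hR ▸ Submodule.subset_span ⟨i, hi.2, rfl⟩⟩, ?_⟩, rfl⟩
    rw [mem_maximalIdeal hn]
    exact (hb.monicAt i hi.2).1 0 (by omega)
  choose! B hB using hB
  have hBspan : ∀ i ∈ E.erase 0, (IsLocalRing.maximalIdeal R).toCotangent (B i) ∈
      Submodule.span K (Set.range fun i =>
        (IsLocalRing.maximalIdeal R).toCotangent (y i)) := by
    intro i hi
    have hi' := Finset.mem_erase.1 hi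
    by_cases hirr : i ∈ irreducibles E
    · obtain ⟨j, rfl⟩ := hdE i hirr
      have : B (d j) = y j := Subtype.ext (Subtype.ext ((hB _ hi).trans (hy j).symm))
      rw [this]
      exact Submodule.subset_span ⟨j, rfl⟩
    · obtain ⟨j, hj, k, hk, rfl, hj0, hk0⟩ :=
        exists_add_of_notMem_irreducibles hi'.2 hi'.1 hirr
      have hj' := hB j (Finset.mem_erase.2 ⟨hj0, hj⟩)
      have hk' := hB k (Finset.mem_erase.2 ⟨hk0, hk⟩)
      have : (B (j + k) : R) = B j * B k := by
        apply Subtype.ext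
        rw [Subalgebra.coe_mul, hB _ hi, hj', hk', hb.mul j hj k hk (hE.1 _ hi'.2)]
      rw [(Ideal.toCotangent_eq_zero _ _).2]
      · exact Submodule.zero_mem _
      · rw [this, pow_two]
        exact Ideal.mul_mem_mul (B j).2 (B k).2
  rintro z -
  obtain ⟨x, rfl⟩ := Ideal.toCotangent_surjective _ z
  obtain ⟨c, hc⟩ := (Submodule.mem_span_image_finset_iff_exists_fun' K).1
    (hb.mem_span_of_mem_maximalIdeal hE hR x.2)
  have hx : x = ∑ i ∈ E.erase 0, c i • B i := by
    apply Subtype.ext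
    apply Subtype.ext
    rw [← hc]
    simp only [AddSubmonoidClass.coe_finsetSum]
    refine Finset.sum_congr rfl fun i hi => ?_
    rw [← hB i hi]
    rfl
  rw [hx, map_sum]
  refine Submodule.sum_mem _ fun i hi => ?_
  rw [toCotangent_smul]
  exact Submodule.smul_mem _ _ (hBspan i hi)

/-- The classes of the `b g`, for `g` irreducible, form a basis of the cotangent space. -/
theorem finrank_cotangent (hb : IsMonomialBasis E b) (hE : IsSubPartialMonoid n E)
    [IsLocalRing R] (hR : R = hb.subalgebra hE) :
    Module.finrank K (IsLocalRing.maximalIdeal R).Cotangent = (irreducibles E).card := by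
  have hB : ∀ i : irreducibles E, ∃ B : IsLocalRing.maximalIdeal R,
      ((B : R) : Trunc K n) = b i := by
    rintro ⟨i, hi⟩
    rw [mem_irreducibles] at hi
    refine ⟨⟨⟨b i, hR ▸ Submodule.subset_span ⟨i, hi.1, rfl⟩⟩, ?_⟩, rfl⟩
    rw [mem_maximalIdeal (hE.1 0 hE.2.1)]
    exact (hb.monicAt i hi.1).1 0 (by omega)
  choose y hy using hB
  have hli := hb.linearIndependent_toCotangent hE hR Subtype.val_injective (fun i => i.2) y hy
  have hsp := hb.span_toCotangent hE hR (fun g hg => ⟨⟨g, hg⟩, rfl⟩) y hy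
  rw [Module.finrank_eq_card_basis (Module.Basis.mk hli hsp), Fintype.card_coe]

end IsMonomialBasis

/-! ### The algebras of a row -/

namespace Row

/-- A single generator of a row, for the parameters `p`. -/
noncomputable def generator (r : Row) (K : Type*) [Field K] (n : ℕ) (p : Fin r.e → K)
    (g : ℕ × List (Fin r.e × ℕ)) : Trunc K n :=
  toTrunc K n (X ^ g.1 + (g.2.map fun t => C (p t.1) * X ^ t.2).sum)

variable {r : Row} {p : Fin r.e → K}

theorem generators_eq : r.generators K n p = r.gens.map (r.generator K n p) := rfl

theorem mem_degrees {g : ℕ × List (Fin r.e × ℕ)} (hg : g ∈ r.gens) : g.1 ∈ r.degrees :=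
  List.mem_map_of_mem hg

theorem cf_generator {j : ℕ} (hj : j < n) (g : ℕ × List (Fin r.e × ℕ)) :
    cf j (r.generator K n p g) =
      (if j = g.1 then 1 else 0) + (g.2.map fun t => if j = t.2 then p t.1 else 0).sum := by
  rw [generator, cf_toTrunc, if_pos hj, coeff_add, coeff_X_pow, ← lcoeff_apply (R := K),
    map_list_sum, List.map_map]
  congr 3
  ext t
  simp [coeff_X_pow]

theorem cf_generator_of_notMem {j : ℕ} (hj : j < n) {g : ℕ × List (Fin r.e × ℕ)}
    (h : j ∉ g.2.map Prod.snd) :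
    cf j (r.generator K n p g) = if j = g.1 then 1 else 0 := by
  rw [cf_generator hj, List.sum_eq_zero, add_zero]
  intro x hx
  obtain ⟨t, ht, rfl⟩ := List.mem_map.1 hx
  exact if_neg fun h' => h (List.mem_map.2 ⟨t, ht, h'.symm⟩)

theorem sum_ite_eq_of_nodup {k : ℕ} (p : Fin k → K) {l : List (Fin k × ℕ)}
    (hl : (l.map Prod.snd).Nodup) {t : Fin k × ℕ} (ht : t ∈ l) :
    (l.map fun s => if t.2 = s.2 then p s.1 else 0).sum = p t.1 := by
  induction l with
  | nil => simp at ht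
  | cons s l ih =>
    rw [List.map_cons, List.nodup_cons] at hl
    rw [List.map_cons, List.sum_cons]
    rcases List.mem_cons.1 ht with rfl | ht
    · rw [if_pos rfl, List.sum_eq_zero, add_zero]
      intro x hx
      obtain ⟨s, hs, rfl⟩ := List.mem_map.1 hx
      exact if_neg fun h' => hl.1 (List.mem_map.2 ⟨s, hs, h'.symm⟩)
    · rw [ih hl.2 ht, if_neg, zero_add]
      exact fun h' => hl.1 (List.mem_map.2 ⟨t, ht, h'⟩)

namespace IsValid

variable (hr : r.IsValid n)
include hr

theorem mem_gaps {g : ℕ × List (Fin r.e × ℕ)} (hg : g ∈ r.gens) {j : ℕ} :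
    j ∈ g.2.map Prod.snd ↔ j < n ∧ g.1 < j ∧ j ∉ r.E := by
  rw [hr.gaps g hg]; simp

theorem mem_irreducibles_iff {i : ℕ} : i ∈ irreducibles r.E ↔ ∃ g ∈ r.gens, g.1 = i := by
  rw [← hr.degrees_toFinset, List.mem_toFinset, degrees, List.mem_map]

theorem mem_E {g : ℕ × List (Fin r.e × ℕ)} (hg : g ∈ r.gens) : g.1 ∈ r.E :=
  (mem_irreducibles.1 (hr.mem_irreducibles_iff.2 ⟨g, hg, rfl⟩)).1

theorem pos : 0 < n := hr.monoid.1 0 hr.monoid.2.1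

theorem eq_of_fst_eq {g g' : ℕ × List (Fin r.e × ℕ)} (hg : g ∈ r.gens) (hg' : g' ∈ r.gens)
    (h : g.1 = g'.1) : g = g' :=
  List.inj_on_of_nodup_map hr.degrees_nodup hg hg' h

/-- Each letter occurs in only one place of the row. -/
theorem eq_of_letter_eq {g g' : ℕ × List (Fin r.e × ℕ)} (hg : g ∈ r.gens) (hg' : g' ∈ r.gens)
    {t t' : Fin r.e × ℕ} (ht : t ∈ g.2) (ht' : t' ∈ g'.2) (h : t.1 = t'.1) : g = g' ∧ t = t' := by
  obtain ⟨h1, h2⟩ := List.nodup_flatMap.1 hr.letters_nodup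
  have hgg : g = g' := by
    by_contra hne
    have : Std.Symm (Function.onFun List.Disjoint fun g : ℕ × List (Fin r.e × ℕ) =>
      g.2.map Prod.fst) := ⟨fun _ _ h => h.symm⟩
    exact h2.forall hg hg' hne (List.mem_map_of_mem ht)
      (h ▸ List.mem_map_of_mem ht')
  subst hgg
  exact ⟨rfl, List.inj_on_of_nodup_map (h1 g hg) ht ht' h⟩

theorem cf_generator_letter {g : ℕ × List (Fin r.e × ℕ)} (hg : g ∈ r.gens) {t : Fin r.e × ℕ}
    (ht : t ∈ g.2) : cf t.2 (r.generator K n p g) = p t.1 := by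
  obtain ⟨h1, h2, -⟩ := (hr.mem_gaps hg).1 (List.mem_map_of_mem ht)
  have hnd : (g.2.map Prod.snd).Nodup := by
    rw [hr.gaps g hg]; exact List.nodup_range.filter _
  rw [cf_generator h1, if_neg h2.ne', zero_add, sum_ite_eq_of_nodup p hnd ht]

theorem monicAt_generator {g : ℕ × List (Fin r.e × ℕ)} (hg : g ∈ r.gens) :
    MonicAt g.1 (r.generator K n p g) := by
  have hgn : g.1 < n := hr.monoid.1 _ (hr.mem_E hg)
  have h : ∀ j ≤ g.1, j ∉ g.2.map Prod.snd := fun j hj hmem => by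
    have := (hr.mem_gaps hg).1 hmem; omega
  refine ⟨fun j hj => ?_, ?_⟩
  · rw [cf_generator_of_notMem (hj.trans hgn) (h j hj.le), if_neg hj.ne]
  · rw [cf_generator_of_notMem hgn (h _ le_rfl), if_pos rfl]

theorem cf_generator_of_mem {g : ℕ × List (Fin r.e × ℕ)} (hg : g ∈ r.gens) {j : ℕ}
    (hj : j ∈ r.E) : cf j (r.generator K n p g) = if j = g.1 then 1 else 0 :=
  cf_generator_of_notMem (hr.monoid.1 j hj) fun h => ((hr.mem_gaps hg).1 h).2.2 hj

/-- Without letters the powers of `x` form a monomial basis; with letters, `E` is free and the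
products of the generators do. -/
theorem exists_isMonomialBasis (p : Fin r.e → K) : ∃ b : ℕ → Trunc K n,
    IsMonomialBasis r.E b ∧ ∀ g ∈ r.gens, b g.1 = r.generator K n p g := by
  rcases hr.free with he | ⟨h1, h2, h3⟩
  · refine ⟨fun i => toTrunc K n (X ^ i), ⟨?_, fun i hi => ?_, fun i _ j _ _ => ?_⟩,
      fun g _ => ?_⟩
    · rw [pow_zero]; exact map_one _
    · exact (monicAt_iff_exists (hr.monoid.1 i hi) _).2 ⟨0, by simp⟩
    · rw [pow_add]; exact (map_mul _ _ _).symm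
    · have : IsEmpty (Fin r.e) := by rw [he]; infer_instance
      have : g.2 = [] := List.eq_nil_iff_forall_not_mem.2 fun t _ => isEmptyElim t.1
      simp [generator, this]
  · have hF : ∃ F : ℕ → Trunc K n, ∀ g ∈ r.gens, F g.1 = r.generator K n p g := by
      classical
      refine ⟨fun i => if h : ∃ g ∈ r.gens, g.1 = i then r.generator K n p h.choose else 0,
        fun g hg => ?_⟩
      have h : ∃ g' ∈ r.gens, g'.1 = g.1 := ⟨g, hg, rfl⟩
      dsimp only
      rw [dif_pos h, hr.eq_of_fst_eq h.choose_spec.1 hg h.choose_spec.2]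
    obtain ⟨F, hF⟩ := hF
    refine ⟨fun i => ((decompose r.degrees r.E n i).map F).prod,
      ⟨?_, fun i hi => ?_, fun i hi j hj hij => ?_⟩, fun g hg => ?_⟩
    · obtain ⟨m, rfl⟩ : ∃ m, n = m + 1 := ⟨n - 1, by have := hr.pos; omega⟩
      simp [decompose]
    · have hsum := (h1 i hi).2
      have := monicAt_list_prod (n := n) (F := F) (decompose r.degrees r.E n i) (fun g hg => ?_)
        (by rw [hsum]; exact hr.monoid.1 i hi)
      · rwa [hsum] at this
      · obtain ⟨g', hg', rfl⟩ := List.mem_map.1 ((h1 i hi).1 g hg)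
        rw [hF g' hg']
        exact hr.monicAt_generator hg'
    · rw [← List.prod_append, ← List.map_append]
      exact ((h3 i hi j hj hij).map F).prod_eq
    · simp [h2 g.1 (mem_degrees hg), hF g hg]

theorem subalgebra_eq {b : ℕ → Trunc K n} (hb : IsMonomialBasis r.E b)
    (hg : ∀ g ∈ r.gens, b g.1 = r.generator K n p g) :
    r.subalgebra K n p = hb.subalgebra hr.monoid := by
  rw [hb.subalgebra_eq_adjoin, Row.subalgebra]
  congr 1
  ext y
  rw [generators_eq, Set.mem_ofPred_eq, List.mem_map]
  constructor
  · rintro ⟨g, hgm, rfl⟩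
    exact ⟨g.1, hr.mem_irreducibles_iff.2 ⟨g, hgm, rfl⟩, hg g hgm⟩
  · rintro ⟨i, hi, rfl⟩
    obtain ⟨g, hgm, rfl⟩ := hr.mem_irreducibles_iff.1 hi
    exact ⟨g, hgm, (hg g hgm).symm⟩

theorem exponents_subalgebra (p : Fin r.e → K) : exponents (r.subalgebra K n p) = r.E := by
  obtain ⟨b, hb, hg⟩ := hr.exists_isMonomialBasis p
  rw [hr.subalgebra_eq hb hg, hb.exponents_subalgebra]

omit hr in
theorem generator_mem {g : ℕ × List (Fin r.e × ℕ)} (hg : g ∈ r.gens) :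
    r.generator K n p g ∈ r.subalgebra K n p :=
  Algebra.subset_adjoin (List.mem_map_of_mem hg)

/-- The generators are the reduced elements of their algebra, so that the letters can be read off
from the algebra. -/
theorem injective_subalgebra : Function.Injective (r.subalgebra K n) := by
  intro p q hpq
  funext k
  obtain ⟨g, hg, hk⟩ := List.mem_flatMap.1 (hr.letters_complete k)
  obtain ⟨t, ht, rfl⟩ := List.mem_map.1 hk
  have hmem : r.generator K n p g - r.generator K n q g ∈ r.subalgebra K n p :=
    Subalgebra.sub_mem _ (generator_mem hg) (hpq ▸ generator_mem hg)
  have h0 := eq_zero_of_cf_exponents hmem fun j hj => by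
    rw [hr.exponents_subalgebra] at hj
    rw [map_sub, hr.cf_generator_of_mem hg hj, hr.cf_generator_of_mem hg hj, sub_self]
  rw [← hr.cf_generator_letter (p := p) hg ht, sub_eq_zero.1 h0, hr.cf_generator_letter hg ht]

theorem exists_subalgebra_eq {R : Subalgebra K (Trunc K n)} (hR : exponents R = r.E) :
    ∃ p, r.subalgebra K n p = R := by
  have h := fun (i : ℕ) (hi : i ∈ exponents R) => exists_reduced hi
  choose! a haR ham ha using h
  choose g hg hk using fun k => List.mem_flatMap.1 (hr.letters_complete k)
  choose t ht htk using fun k => List.mem_map.1 (hk k)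
  -- A letter is the coefficient, at the place where it stands, of the reduced element of `R`.
  set p : Fin r.e → K := fun k => cf (t k).2 (a (g k).1) with hp
  have hgen : ∀ x ∈ r.gens, r.generator K n p x = a x.1 := by
    intro x hx
    have hxR : x.1 ∈ exponents R := hR ▸ hr.mem_E hx
    rw [← sub_eq_zero]
    refine eq_zero_of_cf fun j hj => ?_
    rw [map_sub, sub_eq_zero]
    rcases lt_trichotomy j x.1 with hlt | rfl | hgt
    · rw [(hr.monicAt_generator hx).1 j hlt, (ham _ hxR).1 j hlt]
    · rw [(hr.monicAt_generator hx).2, (ham _ hxR).2]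
    · by_cases hjE : j ∈ r.E
      · rw [hr.cf_generator_of_mem hx hjE, if_neg hgt.ne', ha _ hxR j (hR ▸ hjE) hgt]
      · obtain ⟨s, hs, rfl⟩ := List.mem_map.1 ((hr.mem_gaps hx).2 ⟨hj, hgt, hjE⟩)
        obtain ⟨h1, h2⟩ := hr.eq_of_letter_eq (hg s.1) hx (ht s.1) hs (htk s.1)
        rw [hr.cf_generator_letter hx hs, hp]
        simp only [h1, h2]
  refine ⟨p, eq_of_le_of_exponents_subset (Algebra.adjoin_le fun y hy => ?_) ?_⟩
  · rw [Set.mem_ofPred_eq, generators_eq] at hy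
    obtain ⟨x, hx, rfl⟩ := List.mem_map.1 hy
    rw [hgen x hx]
    exact haR _ (hR ▸ hr.mem_E hx)
  · rw [hr.exponents_subalgebra, hR]

theorem bijOn_subalgebra : Set.BijOn (r.subalgebra K n) Set.univ
    {R : Subalgebra K (Trunc K n) | exponents R = r.E} :=
  ⟨fun p _ => hr.exponents_subalgebra p, hr.injective_subalgebra.injOn, fun _ hR =>
    let ⟨p, hp⟩ := hr.exists_subalgebra_eq hR
    ⟨p, trivial, hp⟩⟩

theorem independentModSq (p : Fin r.e → K) :
    IndependentModSq (r.subalgebra K n p) (r.generators K n p) := by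
  obtain ⟨b, hb, hg⟩ := hr.exists_isMonomialBasis p
  have := isLocalRing hr.pos (r.subalgebra K n p)
  set d : Fin (r.generators K n p).length → ℕ :=
    fun i => (r.gens.get (i.cast (by simp [generators_eq]))).1 with hd
  have hget : ∀ i, (r.generators K n p).get i = b (d i) := fun i => by
    rw [hd, hg _ (List.get_mem _ _)]
    exact List.getElem_map _
  have hdirr : ∀ i, d i ∈ irreducibles r.E := fun i =>
    hr.mem_irreducibles_iff.2 ⟨_, List.get_mem _ _, rfl⟩
  have hinj : Function.Injective d := fun i j hij => by
    have h1 := hr.eq_of_fst_eq (List.get_mem _ _) (List.get_mem _ _) hij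
    have h2 := List.nodup_iff_injective_get.1 (List.Nodup.of_map _ hr.degrees_nodup) h1
    simpa [Fin.ext_iff] using h2
  refine ⟨this, fun i => ⟨⟨(r.generators K n p).get i,
    Algebra.subset_adjoin (List.get_mem _ _)⟩, ?_⟩, fun _ => rfl, ?_⟩
  · rw [mem_maximalIdeal hr.pos]
    change cf 0 ((r.generators K n p).get i) = 0
    rw [hget]
    have h := mem_irreducibles.1 (hdirr i)
    exact (hb.monicAt _ h.1).1 0 (by omega)
  · exact hb.linearIndependent_toCotangent hr.monoid (hr.subalgebra_eq hb hg) hinj hdirr _ hget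

theorem isThin {R : Subalgebra K (Trunc K n)} (hR : exponents R = r.E) : IsThin R := by
  obtain ⟨p, rfl⟩ := hr.exists_subalgebra_eq hR
  obtain ⟨b, hb, hg⟩ := hr.exists_isMonomialBasis p
  have := isLocalRing hr.pos (r.subalgebra K n p)
  refine ⟨this, ?_⟩
  rw [hb.finrank_cotangent hr.monoid (hr.subalgebra_eq hb hg), hR, dInv_eq_card hr.monoid]

end IsValid
end Row
end TruncSubalg

theorem theorem2 (K : Type*) [Field K] (n : ℕ) (hn1 : 1 ≤ n) (hn10 : n ≤ 10) :
    -- every sub-partial-monoid of `[0, n-1]` is listed, exactly once, and nothing else is listed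
    ((TruncSubalg.table n).map TruncSubalg.Row.E).Nodup ∧
    (∀ E : Finset ℕ,
      TruncSubalg.IsSubPartialMonoid n E ↔ ∃ r ∈ TruncSubalg.table n, r.E = E) ∧
    (∀ r ∈ TruncSubalg.table n,
      -- the value of `e(E)` is correct
      TruncSubalg.eInv n r.E = r.e ∧
      -- the subalgebras with exponent set `E` are parametrized, without repetition, by `K^e`
      Set.BijOn (r.subalgebra K n) Set.univ
        {R : Subalgebra K (TruncSubalg.Trunc K n) | TruncSubalg.exponents R = r.E} ∧
      -- the listed generators are linearly independent modulo the square of the maximal ideal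
      ∀ p : Fin r.e → K,
        TruncSubalg.IndependentModSq (r.subalgebra K n p) (r.generators K n p)) ∧
    -- every subalgebra has one of the listed exponent sets, and is thin
    ∀ R : Subalgebra K (TruncSubalg.Trunc K n),
      TruncSubalg.IsSubPartialMonoid n (TruncSubalg.exponents R) ∧ TruncSubalg.IsThin R := by
  have hn : n ∈ Finset.Icc 1 10 := Finset.mem_Icc.2 ⟨hn1, hn10⟩
  have hvalid := TruncSubalg.isValid_of_mem_table n hn
  refine ⟨TruncSubalg.nodup_table n hn, fun E => ⟨TruncSubalg.mem_table hn1 hn10, ?_⟩,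
    fun r hr => ⟨?_, (hvalid r hr).bijOn_subalgebra, (hvalid r hr).independentModSq⟩,
    fun R => ?_⟩
  · rintro ⟨r, hr, rfl⟩
    exact (hvalid r hr).monoid
  · rw [TruncSubalg.eInv_eq_eCount n r.E (hvalid r hr).monoid, (hvalid r hr).eCount_eq]
  · have hR := TruncSubalg.isSubPartialMonoid_exponents hn1 R
    obtain ⟨r, hr, hE⟩ := TruncSubalg.mem_table hn1 hn10 hR
    exact ⟨hR, (hvalid r hr).isThin hE.symm⟩
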